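/- **Theorem.** A Markov chain $\langle M,\mu,w\rangle$ on $n$ vertices consists of a stochastic matrix $M\in\mathbb{Q}^{n\times n}$, an initial distribution $\mu\in\mathbb{Q}^n$ (a row vector with nonnegative entries of sum $1$) and a weight vector $w\in\mathbb{Q}^n$. Let $W=\max_v|w(v)|$, let $\alpha=\min\{M_{ij}\mid M_{ij}>0\}$ be its smallest non-zero transition probability, and let $K_3=(1-\alpha^{n^3})^{1/(3n^2)}$. Its utilities are $u_t=\sum_{i=0}^{t}\mu M^i w^{\top}$ for $t\ge 0$, and its optimal expected value with expected stopping time $T\ge 0$ is $$\mathrm{val}(M,T)=\inf\Big\{\sum_{t\ge 0}\delta(t)\,u_t \;\Big|\; \delta:\mathbb{N}\to[0,1],\ \sum_{t}\delta(t)=1,\ \sum_{t}t\,\delta(t)=T\Big\}.$$ Running time is counted in elementary steps (arithmetic operations, comparisons and memory accesses, each at unit cost) of a random-access machine with rational registers and arrays, natural-number index registers, and no rounding operation. There is one algorithm that, given any Markov chain, any rational $T\ge 0$ and any rational $\epsilon>0$, halts with a rational number $v$ such that $|\mathrm{val}(M,T)-v|\le\epsilon$, and whose running time satisfies all of the following.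 1. There are a polynomial $P$ and a constant $c$ such that the running time is always at most $$P(n)\cdot \max(1,T)\cdot \max\Big(1,\frac{\min\big(-1,\ln\frac{\epsilon}{nW}\big)}{\ln K_3}\Big)\cdot 2^{cn},$$ where the last-but-one factor is read with $\min(-1,\ln\frac{\epsilon}{nW})=-1$ if $W=0$, and is $1$ if $\alpha=1$. In particular, for $T\ge 1$, $\epsilon\le nW/e$ and $\alpha<1$, it is at most $P(n)\cdot T\cdot\frac{\ln(\epsilon/(nW))}{\ln K_3}\cdot 2^{cn}$. 2. (Constant $\alpha$.) There are a polynomial $P$ and a constant $c$, which do not depend on $\alpha$, such that the running time is always at most $$\frac{P(n)\cdot 2^{cn}}{\alpha^{n^3}}\cdot \max(1,T)\cdot \max\Big(1,\ln\frac{nW}{\epsilon}\Big).$$ 3. (Constant $n$.) For every $n$ there are constants $c_n$ and $e_n$ such that for all Markov chains on $n$ vertices the running time is at most $$c_n\cdot\frac{1}{\alpha^{e_n}}\cdot \max(1,T)\cdot \max\Big(1,\ln\frac{W}{\epsilon}\Big).$$ In 2 and 3 the last factor is $1$ if $W=0$. -/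

import Mathlib

open scoped Matrix

/-! ### Markov chains with weights and their value with expected stopping time -/

/-- A Markov chain `⟨M, μ, w⟩` on `n` vertices: a rational stochastic matrix, a rational initial
distribution and a rational weight vector. -/
structure MarkovChain (n : ℕ) where
  M : Matrix (Fin n) (Fin n) ℚ
  μ : Fin n → ℚ
  w : Fin n → ℚ
  stochastic : M ∈ Matrix.rowStochastic ℚ (Fin n)
  initial : μ ∈ stdSimplex ℚ (Fin n)

/-- A stopping-time distribution: `δ : ℕ → [0,1]` with `∑ t, δ t = 1`. -/
def IsStoppingTimeDistribution (δ : ℕ → ℝ) : Prop :=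
  (∀ t, δ t ∈ Set.Icc (0 : ℝ) 1) ∧ HasSum δ 1

/-- The expected time of `δ` exists and is equal to `T`. -/
def HasExpectedTime (δ : ℕ → ℝ) (T : ℝ) : Prop :=
  HasSum (fun t : ℕ => (t : ℝ) * δ t) T

namespace MarkovChain

variable {n : ℕ}

/-- The utility `u t = ∑_{i=0}^{t} μ · M^i · wᵀ`. -/
def utility (C : MarkovChain n) (t : ℕ) : ℚ :=
  ∑ i ∈ Finset.range (t + 1), (C.μ ᵥ* C.M ^ i) ⬝ᵥ C.w

/-- The optimal (worst-case) expected value with expected stopping time `T`. As `u` grows at most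
linearly, all the series converge for the distributions in question, and for `T ≥ 0` the infimum
is that of a non-empty set that is bounded below. -/
noncomputable def val (C : MarkovChain n) (T : ℝ) : ℝ :=
  sInf {x : ℝ | ∃ δ : ℕ → ℝ, IsStoppingTimeDistribution δ ∧ HasExpectedTime δ T ∧
    x = ∑' t, δ t * (C.utility t : ℝ)}

/-- Some transition has positive probability. -/
theorem exists_pos (C : MarkovChain n) :
    (Finset.univ.filter fun p : Fin n × Fin n => 0 < C.M p.1 p.2).Nonempty := by
  have hM := Matrix.mem_rowStochastic_iff_sum.1 C.stochastic
  have hi : ∃ i : Fin n, True := by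
    by_contra h
    have hs := C.initial.2
    have : IsEmpty (Fin n) := ⟨fun i => h ⟨i, trivial⟩⟩
    simp at hs
  obtain ⟨i, -⟩ := hi
  obtain ⟨j, -, hj⟩ : ∃ j ∈ Finset.univ, 0 < C.M i j := by
    apply Finset.exists_lt_of_sum_lt
    rw [hM.2 i]
    simp
  exact ⟨(i, j), by simpa using hj⟩

/-- The smallest non-zero transition probability `α = min {M i j | M i j > 0}`. -/
def minProb (C : MarkovChain n) : ℚ :=
  (Finset.univ.filter fun p : Fin n × Fin n => 0 < C.M p.1 p.2).inf' C.exists_pos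
    fun p => C.M p.1 p.2

/-- `K₃ = (1 - α ^ (n³)) ^ (1 / (3 n²))`. -/
noncomputable def K₃ (C : MarkovChain n) : ℝ :=
  (1 - (C.minProb : ℝ) ^ n ^ 3) ^ (1 / (3 * (n : ℝ) ^ 2))

end MarkovChain

/-! ### A machine model with a step count

A uniform random-access machine with natural-number index registers, rational registers and
arrays of rationals, programmed by structured programs. Every arithmetic operation, comparison,
register access and array access costs one step, irrespective of the size of the numbers. There is
no rounding operation, and no way to inspect the digits of a rational number. -/

namespace RAM

/-- The memory: index registers, rational registers, and rational arrays (by name and index). -/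
structure State where
  idx : ℕ → ℕ
  reg : ℕ → ℚ
  arr : ℕ → ℕ → ℚ

/-- Index expressions. -/
inductive NExpr where
  | const (k : ℕ)
  | var (x : ℕ)
  | add (a b : NExpr)
  | sub (a b : NExpr)
  | mul (a b : NExpr)

/-- The value of an index expression (subtraction is truncated). -/
def NExpr.eval (s : State) : NExpr → ℕ
  | const k => k
  | var x => s.idx x
  | add a b => a.eval s + b.eval s
  | sub a b => a.eval s - b.eval s
  | mul a b => a.eval s * b.eval s

/-- The number of elementary steps for evaluating an index expression. -/
def NExpr.cost : NExpr → ℕ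
  | const _ => 1
  | var _ => 1
  | add a b => a.cost + b.cost + 1
  | sub a b => a.cost + b.cost + 1
  | mul a b => a.cost + b.cost + 1

/-- Rational expressions: `get a e` reads entry `e` of array `a`, and `ofIdx e` converts a natural
number to a rational number. -/
inductive QExpr where
  | const (c : ℚ)
  | var (x : ℕ)
  | get (a : ℕ) (e : NExpr)
  | ofIdx (e : NExpr)
  | add (a b : QExpr)
  | sub (a b : QExpr)
  | mul (a b : QExpr)
  | div (a b : QExpr)

/-- The value of a rational expression (division by zero yields zero). -/
def QExpr.eval (s : State) : QExpr → ℚ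
  | const c => c
  | var x => s.reg x
  | get a e => s.arr a (e.eval s)
  | ofIdx e => (e.eval s : ℚ)
  | add a b => a.eval s + b.eval s
  | sub a b => a.eval s - b.eval s
  | mul a b => a.eval s * b.eval s
  | div a b => a.eval s / b.eval s

/-- The number of elementary steps for evaluating a rational expression. -/
def QExpr.cost : QExpr → ℕ
  | const _ => 1
  | var _ => 1
  | get _ e => e.cost + 1
  | ofIdx e => e.cost + 1
  | add a b => a.cost + b.cost + 1
  | sub a b => a.cost + b.cost + 1
  | mul a b => a.cost + b.cost + 1
  | div a b => a.cost + b.cost + 1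

/-- Tests. -/
inductive Test where
  | ltN (a b : NExpr)
  | ltQ (a b : QExpr)

/-- The outcome of a test. -/
def Test.holds (s : State) : Test → Prop
  | ltN a b => a.eval s < b.eval s
  | ltQ a b => a.eval s < b.eval s

/-- The number of elementary steps for a test. -/
def Test.cost : Test → ℕ
  | ltN a b => a.cost + b.cost + 1
  | ltQ a b => a.cost + b.cost + 1

/-- Programs: assignments to index registers, rational registers and array entries, composition,
branching, and loops. -/
inductive Prog where
  | skip
  | setIdx (x : ℕ) (e : NExpr)
  | setReg (x : ℕ) (e : QExpr)
  | setArr (a : ℕ) (i : NExpr) (e : QExpr)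
  | seq (p q : Prog)
  | ite (b : Test) (p q : Prog)
  | loop (b : Test) (p : Prog)

/-- `Exec p s k s'`: started in `s`, the program `p` halts in `s'` after exactly `k` steps.
The program `loop b p` repeats `p` as long as the test `b` holds. -/
inductive Exec : Prog → State → ℕ → State → Prop where
  | skip (s : State) : Exec Prog.skip s 1 s
  | setIdx (x : ℕ) (e : NExpr) (s : State) :
      Exec (Prog.setIdx x e) s (e.cost + 1) { s with idx := Function.update s.idx x (e.eval s) }
  | setReg (x : ℕ) (e : QExpr) (s : State) :
      Exec (Prog.setReg x e) s (e.cost + 1) { s with reg := Function.update s.reg x (e.eval s) }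
  | setArr (a : ℕ) (i : NExpr) (e : QExpr) (s : State) :
      Exec (Prog.setArr a i e) s (i.cost + e.cost + 1)
        { s with
          arr := Function.update s.arr a (Function.update (s.arr a) (i.eval s) (e.eval s)) }
  | seq {p q : Prog} {s s₁ s₂ : State} {k l : ℕ} :
      Exec p s k s₁ → Exec q s₁ l s₂ → Exec (Prog.seq p q) s (k + l) s₂
  | ite_true {b : Test} {p q : Prog} {s s' : State} {k : ℕ} :
      b.holds s → Exec p s k s' → Exec (Prog.ite b p q) s (b.cost + k) s'
  | ite_false {b : Test} {p q : Prog} {s s' : State} {k : ℕ} :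
      ¬ b.holds s → Exec q s k s' → Exec (Prog.ite b p q) s (b.cost + k) s'
  | loop_true {b : Test} {p : Prog} {s s₁ s₂ : State} {k l : ℕ} :
      b.holds s → Exec p s k s₁ → Exec (Prog.loop b p) s₁ l s₂ →
      Exec (Prog.loop b p) s (b.cost + k + l) s₂
  | loop_false {b : Test} {p : Prog} {s : State} :
      ¬ b.holds s → Exec (Prog.loop b p) s b.cost s

/-- The machine is deterministic: a program has at most one halting run from a given state. -/
theorem Exec.det {p : Prog} {s s₁ s₂ : State} {k₁ k₂ : ℕ}
    (h₁ : Exec p s k₁ s₁) (h₂ : Exec p s k₂ s₂) : k₁ = k₂ ∧ s₁ = s₂ := by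
  induction h₁ generalizing k₂ s₂ with
  | skip => cases h₂; exact ⟨rfl, rfl⟩
  | setIdx => cases h₂; exact ⟨rfl, rfl⟩
  | setReg => cases h₂; exact ⟨rfl, rfl⟩
  | setArr => cases h₂; exact ⟨rfl, rfl⟩
  | seq _ _ ih₁ ih₂ =>
    cases h₂ with
    | seq a b =>
      obtain ⟨rfl, rfl⟩ := ih₁ a
      obtain ⟨rfl, rfl⟩ := ih₂ b
      exact ⟨rfl, rfl⟩
  | ite_true hb _ ih =>
    cases h₂ with
    | ite_true _ a => obtain ⟨rfl, rfl⟩ := ih a; exact ⟨rfl, rfl⟩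
    | ite_false hn _ => exact absurd hb hn
  | ite_false hb _ ih =>
    cases h₂ with
    | ite_true hn _ => exact absurd hn hb
    | ite_false _ a => obtain ⟨rfl, rfl⟩ := ih a; exact ⟨rfl, rfl⟩
  | loop_true hb _ _ ih₁ ih₂ =>
    cases h₂ with
    | loop_true _ a b =>
      obtain ⟨rfl, rfl⟩ := ih₁ a
      obtain ⟨rfl, rfl⟩ := ih₂ b
      exact ⟨rfl, rfl⟩
    | loop_false hn => exact absurd hb hn
  | loop_false hb =>
    cases h₂ with
    | loop_true hn _ _ => exact absurd hn hb
    | loop_false _ => exact ⟨rfl, rfl⟩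

/-- The initial memory: index register `0` holds `n`; rational registers `0` and `1` hold `T` and
`ε`; arrays `0`, `1` and `2` hold `μ`, `w` and (row by row) `M`; everything else is zero. -/
def input {n : ℕ} (C : MarkovChain n) (T ε : ℚ) : State where
  idx x := if x = 0 then n else 0
  reg x := if x = 0 then T else if x = 1 then ε else 0
  arr a k :=
    if a = 0 then (if h : k < n then C.μ ⟨k, h⟩ else 0)
    else if a = 1 then (if h : k < n then C.w ⟨k, h⟩ else 0)
    else if a = 2 then
      (if h : k < n * n then C.M (finProdFinEquiv.symm ⟨k, h⟩).1 (finProdFinEquiv.symm ⟨k, h⟩).2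
       else 0)
    else 0

/-- On input `(C, T, ε)` the program `A` halts after at most `b` steps, and rational register `0`
then holds an approximation with additive error `ε` of the optimal value `val C T`. -/
def ApproximatesWithin (A : Prog) {n : ℕ} (C : MarkovChain n) (T ε : ℚ) (b : ℝ) : Prop :=
  ∃ (k : ℕ) (s : State), Exec A (input C T ε) k s ∧
    |C.val (T : ℝ) - (s.reg 0 : ℝ)| ≤ (ε : ℝ) ∧ (k : ℝ) ≤ b

end RAM

/-!
The value `val C T` is the lower convex envelope at `T` of the sequence of utilities: every
stopping-time distribution with mean `T` lies above a supporting line (`exists_line_le`,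
`le_tsum_mul_of_line_le`), and the two-point distributions attain the chords over `T`
(`exists_tsum_mul_eq_chord`). So the value is the infimum of all chords `[s, t]` with `s ≤ T < t`,
and the task is to truncate `t`.

Let `α` be the least positive transition probability, `β = α ^ n²`, and let `p = lcm (1, …, n)`, a
multiple of the periods of all recurrent classes. A recurrent state `i` has a return time `d ≤ n`,
and on the states that `i` reaches in multiples of `d` steps the matrix `M ^ (d n)` has a column
with entries at least `β`. By Doeblin's argument the oscillation of `M ^ t w` on this set shrinks
by `1 - β` in every `n²` steps (`Matrix.IsRecurrent.abs_pow_add_mulVec_sub_le`), and it bounds the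
change of `M ^ t w` at `i` over `p` steps. The mass on states that are not recurrent shrinks by the
same factor (`Matrix.pow_mulVec_indicator_le`). Hence the increments `u (t + p) - u t` of the
utilities converge at the rate `(1 - β) ^ (t / (2 n²))`. If they are almost constant after time `B`
(`MarkovChain.mul_abs_utility_add_sub_le`), then a chord that ends beyond `B + p` is, up to a small
error, at least the lower of a chord that ends in `(B, B + p]` and the ray of slope
`a = (u (B + p) - u B) / p` (`sub_le_chord`); conversely chords with a distant end approach the ray
(`le_ray_of_forall_le_chord`). So the least chord or ray over the finite horizon approximates the
value (`MarkovChain.abs_val_sub_le`).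

The horizon is `B = ⌊T⌋ + 2 n² k`, with a number `k` of rounds that does not depend on `T`: the
error in `a` enters multiplied by `T`, but `T (1 - β) ^ (T / (2 n²))` is bounded. Therefore the
brute-force minimum over `s ≤ T < t ≤ B + p` looks at about `T (2 n² k + p)` pairs, which is linear
in `T`. Since `p ≤ 2 ^ (8 n)` by Chebyshev's bound, and `k` is about `ln (n W / ε) / β` plus terms
that the gap between the exponents `n²` and `n³` absorbs (`MarkovChain.exists_rounds`), the first
two bounds follow; the third one is a special case of the second. If `α = 1`, then `1 - β = 0` and
one round suffices.

The program is verified with a Hoare logic for total correctness with step bounds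
(`RAM.Runs.loop`, `RAM.Runs.forLoop`), in which registers that a program does not assign to are
kept track of syntactically (`RAM.Exec.frame`).
-/

/-! ### Mixing of stochastic matrices -/

namespace Matrix

/-- If an entry of some power is non-zero, then so is that entry of a power below the size of the
matrix: by Cayley–Hamilton every power is a combination of these. -/
theorem exists_pow_apply_ne_zero {R ι : Type*} [Field R] [Fintype ι] [DecidableEq ι]
    (M : Matrix ι ι R) {k : ℕ} {i j : ι} (h : (M ^ k) i j ≠ 0) :
    ∃ l < Fintype.card ι, (M ^ l) i j ≠ 0 := by
  by_contra! hcon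
  apply h
  have hne : Nonempty ι := ⟨i⟩
  rw [Matrix.pow_eq_aeval_mod_charpoly M k, Polynomial.aeval_eq_sum_range'
    (n := Fintype.card ι), Matrix.sum_apply]
  · refine Finset.sum_eq_zero fun l hl => ?_
    rw [Matrix.smul_apply, hcon l (Finset.mem_range.1 hl), smul_zero]
  · rw [← M.charpoly_natDegree_eq_dim]
    refine Polynomial.natDegree_modByMonic_lt _ M.charpoly_monic fun h1 => ?_
    have := M.charpoly_natDegree_eq_dim
    rw [h1, Polynomial.natDegree_one] at this
    exact Fintype.card_ne_zero this.symm

theorem mul_apply_le_mul_apply {R ι : Type*} [Semiring R] [PartialOrder R] [IsOrderedRing R]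
    [Fintype ι] {A B : Matrix ι ι R} (hA : ∀ i j, 0 ≤ A i j)
    (hB : ∀ i j, 0 ≤ B i j)
    (i j l : ι) : A i j * B j l ≤ (A * B) i l := by
  rw [Matrix.mul_apply]
  exact Finset.single_le_sum (f := fun x => A i x * B x l)
    (fun x _ => mul_nonneg (hA _ _) (hB _ _)) (Finset.mem_univ j)

variable {𝕜 ι : Type*} [Field 𝕜] [LinearOrder 𝕜] [IsStrictOrderedRing 𝕜]
  [Fintype ι] [DecidableEq ι] {M : Matrix ι ι 𝕜}

theorem rowStochastic_pow_apply_nonneg (hM : M ∈ rowStochastic 𝕜 ι) (k : ℕ) (i j : ι) :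
    0 ≤ (M ^ k) i j :=
  nonneg_of_mem_rowStochastic (pow_mem hM k)

theorem exists_lt_pow_apply_pos (hM : M ∈ rowStochastic 𝕜 ι) {k : ℕ} {i j : ι}
    (h : 0 < (M ^ k) i j) : ∃ l < Fintype.card ι, 0 < (M ^ l) i j := by
  obtain ⟨l, hl, h'⟩ := exists_pow_apply_ne_zero M h.ne'
  exact ⟨l, hl, (rowStochastic_pow_apply_nonneg hM l i j).lt_of_ne' h'⟩

theorem pow_add_apply_pos (hM : M ∈ rowStochastic 𝕜 ι) {k l : ℕ} {i j x : ι}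
    (h : 0 < (M ^ k) i j) (h' : 0 < (M ^ l) j x) : 0 < (M ^ (k + l)) i x := by
  rw [pow_add]
  exact (mul_pos h h').trans_le
    (mul_apply_le_mul_apply (rowStochastic_pow_apply_nonneg hM k)
      (rowStochastic_pow_apply_nonneg hM l) i j x)

theorem pow_mul_apply_pos (hM : M ∈ rowStochastic 𝕜 ι) {k : ℕ} {i : ι}
    (h : 0 < (M ^ k) i i) (r : ℕ) : 0 < (M ^ (k * r)) i i := by
  induction r with
  | zero => simp
  | succ r ih => rw [Nat.mul_succ]; exact pow_add_apply_pos hM ih h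

theorem exists_apply_pos (hM : M ∈ rowStochastic 𝕜 ι) (i : ι) : ∃ j, 0 < M i j := by
  by_contra! h
  have := sum_row_of_mem_rowStochastic hM i
  linarith [Finset.sum_nonpos fun j (_ : j ∈ Finset.univ) => h j]

/-- Positive entries of `M ^ k` are at least `α ^ k` if positive entries of `M` are at least `α`. -/
theorem pow_le_pow_apply (hM : M ∈ rowStochastic 𝕜 ι) {α : 𝕜} (hα : 0 ≤ α)
    (hmin : ∀ i j, 0 < M i j → α ≤ M i j) (k : ℕ) (i j : ι) (h : 0 < (M ^ k) i j) :
    α ^ k ≤ (M ^ k) i j := by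
  induction k generalizing j with
  | zero =>
    obtain rfl : i = j := by
      by_contra hij
      simp [hij] at h
    simp
  | succ k ih =>
    rw [pow_succ, Matrix.mul_apply] at h
    obtain ⟨l, -, hl⟩ := Finset.exists_lt_of_sum_lt (s := Finset.univ) (f := fun _ => (0 : 𝕜))
      (by simpa using h)
    have h1 : 0 < (M ^ k) i l :=
      (rowStochastic_pow_apply_nonneg hM k i l).lt_of_ne' fun h0 => by simp [h0] at hl
    have h2 : 0 < M l j := pos_of_mul_pos_right hl h1.le
    rw [pow_succ, pow_succ]
    exact (mul_le_mul (ih l h1) (hmin l j h2) hα h1.le).trans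
      (mul_apply_le_mul_apply (B := M) (rowStochastic_pow_apply_nonneg hM k)
        (fun _ _ => nonneg_of_mem_rowStochastic hM)
        i l j)

theorem mulVec_apply_le (hM : M ∈ rowStochastic 𝕜 ι) {x : ι → 𝕜} {b : 𝕜} {i : ι}
    (hx : ∀ j, 0 < M i j → x j ≤ b) : (M *ᵥ x) i ≤ b := by
  calc (M *ᵥ x) i = ∑ j, M i j * x j := rfl
    _ ≤ ∑ j, M i j * b := by
      refine Finset.sum_le_sum fun j _ => ?_
      rcases (nonneg_of_mem_rowStochastic hM (i := i) (j := j)).eq_or_lt with h | h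
      · simp [← h]
      · exact mul_le_mul_of_nonneg_left (hx j h) h.le
    _ = b := by rw [← Finset.sum_mul, sum_row_of_mem_rowStochastic hM, one_mul]

theorem le_mulVec_apply (hM : M ∈ rowStochastic 𝕜 ι) {x : ι → 𝕜} {b : 𝕜} {i : ι}
    (hx : ∀ j, 0 < M i j → b ≤ x j) : b ≤ (M *ᵥ x) i := by
  have := mulVec_apply_le hM (x := -x) (b := -b) (i := i) fun j hj => neg_le_neg (hx j hj)
  rw [Matrix.mulVec_neg] at this
  exact neg_le_neg_iff.1 this

theorem abs_mulVec_apply_le (hM : M ∈ rowStochastic 𝕜 ι) {x : ι → 𝕜} {b : 𝕜}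
    (hx : ∀ j, |x j| ≤ b) (i : ι) : |(M *ᵥ x) i| ≤ b :=
  abs_le.2 ⟨le_mulVec_apply hM fun j _ => (abs_le.1 (hx j)).1,
    mulVec_apply_le hM fun j _ => (abs_le.1 (hx j)).2⟩

/-- Doeblin's contraction: if the rows of `M` in a closed set `C` share a column with entries at
least `β`, then `M` shrinks the oscillation on `C` by the factor `1 - β`. -/
theorem exists_mem_Icc_mulVec_of_le (hM : M ∈ rowStochastic 𝕜 ι) {C : Set ι}
    (hC : ∀ j ∈ C, ∀ l, 0 < M j l → l ∈ C) {i : ι} (hi : i ∈ C) {β : 𝕜}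
    (hβ : ∀ j ∈ C, β ≤ M j i) {x : ι → 𝕜} {D : 𝕜}
    (hx : ∃ a, ∀ j ∈ C, x j ∈ Set.Icc a (a + D)) :
    ∃ a, ∀ j ∈ C, (M *ᵥ x) j ∈ Set.Icc a (a + (1 - β) * D) := by
  obtain ⟨a, ha⟩ := hx
  refine ⟨β * x i + (1 - β) * a, fun j hj => ?_⟩
  -- split off the mass `β` that every row puts on the shared column
  set r : ι → 𝕜 := fun l => M j l - if l = i then β else 0 with hr
  have hr0 : ∀ l, 0 ≤ r l := by
    intro l
    simp only [hr]
    split_ifs with h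
    · subst h; exact sub_nonneg.2 (hβ j hj)
    · simpa using nonneg_of_mem_rowStochastic hM
  have hrs : ∑ l, r l = 1 - β := by
    simp [hr, Finset.sum_sub_distrib, sum_row_of_mem_rowStochastic hM]
  have hMx : (M *ᵥ x) j = β * x i + ∑ l, r l * x l := by
    simp [hr, sub_mul, Finset.sum_sub_distrib, Matrix.mulVec, dotProduct]
  have hrC : ∀ l, r l ≠ 0 → l ∈ C := by
    intro l hl
    by_cases h : l = i
    · rwa [h]
    · refine hC j hj l ((nonneg_of_mem_rowStochastic hM).lt_of_ne' fun h0 => hl ?_)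
      simp [hr, h, h0]
  have lo : ∑ l, r l * a ≤ ∑ l, r l * x l := by
    refine Finset.sum_le_sum fun l _ => ?_
    by_cases h : r l = 0
    · simp [h]
    · exact mul_le_mul_of_nonneg_left (ha l (hrC l h)).1 (hr0 l)
  have hi : ∑ l, r l * x l ≤ ∑ l, r l * (a + D) := by
    refine Finset.sum_le_sum fun l _ => ?_
    by_cases h : r l = 0
    · simp [h]
    · exact mul_le_mul_of_nonneg_left (ha l (hrC l h)).2 (hr0 l)
  rw [← Finset.sum_mul, hrs] at lo hi
  rw [hMx]
  constructor <;> linarith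

/-- A state is recurrent if it can be reached back from every state that it reaches. -/
def IsRecurrent (M : Matrix ι ι 𝕜) (i : ι) : Prop :=
  ∀ j k, 0 < (M ^ k) i j → ∃ l, 0 < (M ^ l) j i

theorem IsRecurrent.of_pos (hM : M ∈ rowStochastic 𝕜 ι) {i j : ι} (hi : M.IsRecurrent i) {k : ℕ}
    (h : 0 < (M ^ k) i j) : M.IsRecurrent j := by
  intro l r hl
  obtain ⟨s, hs⟩ := hi l _ (pow_add_apply_pos hM h hl)
  exact ⟨_, pow_add_apply_pos hM hs h⟩

theorem exists_isRecurrent (hM : M ∈ rowStochastic 𝕜 ι) (i : ι) :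
    ∃ j k, 0 < (M ^ k) i j ∧ M.IsRecurrent j := by
  classical
  -- a state reachable from `i` that reaches as few states as possible is recurrent
  let reach : ι → Finset ι := fun j => Finset.univ.filter fun l => ∃ k, 0 < (M ^ k) j l
  obtain ⟨j, hj, hmin⟩ := (reach i).exists_min_image (fun j => (reach j).card)
    ⟨i, by simpa [reach] using ⟨0, by simp⟩⟩
  simp only [reach, Finset.mem_filter, Finset.mem_univ, true_and] at hj
  obtain ⟨k, hk⟩ := hj
  refine ⟨j, k, hk, fun l r hl => ?_⟩
  have hsub : reach l ⊆ reach j := by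
    intro x hx
    simp only [reach, Finset.mem_filter, Finset.mem_univ, true_and] at hx ⊢
    obtain ⟨s, hs⟩ := hx
    exact ⟨_, pow_add_apply_pos hM hl hs⟩
  have hle := hmin l (by simpa [reach] using ⟨_, pow_add_apply_pos hM hk hl⟩)
  have hjm : j ∈ reach l := by
    rw [Finset.eq_of_subset_of_card_le hsub hle]
    simpa [reach] using ⟨0, by simp⟩
  simpa [reach] using hjm

theorem IsRecurrent.exists_return (hM : M ∈ rowStochastic 𝕜 ι) {i : ι} (hi : M.IsRecurrent i) :
    ∃ d, 0 < d ∧ d ≤ Fintype.card ι ∧ 0 < (M ^ d) i i := by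
  obtain ⟨j, hj⟩ := exists_apply_pos hM i
  have hj1 : 0 < (M ^ 1) i j := by simpa using hj
  obtain ⟨l, hl⟩ := hi j 1 hj1
  obtain ⟨r, hr, hr'⟩ := exists_lt_pow_apply_pos hM hl
  exact ⟨1 + r, by omega, by omega, pow_add_apply_pos hM hj1 hr'⟩

/-- For a recurrent state `i` with return time `d`, the states that `i` reaches in multiples of `d`
steps form a closed set of `M ^ d`, on which `M ^ (d * card ι)` has a column with entries at least
`α ^ (card ι) ^ 2`. -/
theorem IsRecurrent.pow_le_apply (hM : M ∈ rowStochastic 𝕜 ι) {α : 𝕜} (hα : 0 ≤ α) (hα1 : α ≤ 1)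
    (hmin : ∀ i j, 0 < M i j → α ≤ M i j) {i : ι} (hi : M.IsRecurrent i) {d : ℕ}
    (hdn : d ≤ Fintype.card ι) (hd : 0 < (M ^ d) i i) {j : ι}
    (hj : ∃ k, 0 < (M ^ (d * k)) i j) :
    α ^ (Fintype.card ι) ^ 2 ≤ (M ^ (d * Fintype.card ι)) j i := by
  obtain ⟨k, hk⟩ := hj
  obtain ⟨r, hr⟩ := hi j _ hk
  have hret : 0 < (M ^ (d * (k * (d - 1) + r))) j i := by
    -- going round the loop `j → i → j` often enough makes the number of steps divisible by `d`
    rcases Nat.eq_zero_or_pos d with rfl | hd0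
    · have : i = j := by
        by_contra hij
        simp [hij] at hk
      subst this; simp
    · have h1 := pow_add_apply_pos hM hr (pow_mul_apply_pos hM (pow_add_apply_pos hM hk hr) (d - 1))
      convert h1 using 3
      obtain ⟨e, rfl⟩ : ∃ e, d = e + 1 := ⟨d - 1, by omega⟩
      simp only [Nat.add_sub_cancel]
      ring
  rw [pow_mul] at hret
  obtain ⟨s, hs, hs'⟩ := exists_lt_pow_apply_pos (pow_mem hM d) hret
  have hloop := pow_mul_apply_pos hM hd (Fintype.card ι - s)
  rw [← pow_mul] at hs'
  have hpos := pow_add_apply_pos hM hs' hloop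
  rw [← mul_add, Nat.add_sub_cancel' hs.le] at hpos
  refine le_trans ?_ (pow_le_pow_apply hM hα hmin _ _ _ hpos)
  refine pow_le_pow_of_le_one hα hα1 ?_
  rw [sq]
  exact Nat.mul_le_mul_right _ hdn

/-- At a recurrent state, the expectation of `x` becomes periodic at a geometric rate; every
multiple of all possible return times is a period. -/
theorem IsRecurrent.abs_pow_add_mulVec_sub_le (hM : M ∈ rowStochastic 𝕜 ι) {α : 𝕜} (hα : 0 ≤ α)
    (hα1 : α ≤ 1) (hmin : ∀ i j, 0 < M i j → α ≤ M i j) {p : ℕ}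
    (hp : ∀ d, 0 < d → d ≤ Fintype.card ι → d ∣ p) {x : ι → 𝕜} {W : 𝕜} (hx : ∀ j, |x j| ≤ W)
    {i : ι} (hi : M.IsRecurrent i) {s k : ℕ} (hs : (Fintype.card ι) ^ 2 * k ≤ s) :
    |(M ^ (s + p) *ᵥ x) i - (M ^ s *ᵥ x) i| ≤ 2 * W * (1 - α ^ (Fintype.card ι) ^ 2) ^ k := by
  obtain ⟨d, hd0, hdn, hd⟩ := hi.exists_return hM
  set β := α ^ (Fintype.card ι) ^ 2 with hβ
  set n := Fintype.card ι with hn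
  set C : Set ι := {j | ∃ k, 0 < (M ^ (d * k)) i j} with hCdef
  have hiC : i ∈ C := ⟨0, by simp⟩
  have hclosed : ∀ q, ∀ j ∈ C, ∀ l, 0 < (M ^ (d * q)) j l → l ∈ C := by
    rintro q j ⟨k, hk⟩ l hl
    exact ⟨k + q, by rw [mul_add]; exact pow_add_apply_pos hM hk hl⟩
  have hosc : ∀ r k, ∃ a, ∀ j ∈ C,
      (M ^ (d * n * k + r) *ᵥ x) j ∈ Set.Icc a (a + (1 - β) ^ k * (2 * W)) := by
    intro r k
    induction k with
    | zero =>
      refine ⟨-W, fun j _ => ?_⟩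
      have := abs_le.1 (abs_mulVec_apply_le (pow_mem hM r) hx j)
      simp only [Nat.mul_zero, zero_add, pow_zero, one_mul]
      exact ⟨this.1, by linarith [this.2]⟩
    | succ k ih =>
      obtain ⟨a, ha⟩ := exists_mem_Icc_mulVec_of_le (pow_mem hM (d * n)) (hclosed n) hiC
        (fun j hj => hi.pow_le_apply hM hα hα1 hmin hdn hd hj) ih
      refine ⟨a, fun j hj => ?_⟩
      have := ha j hj
      rwa [Matrix.mulVec_mulVec, ← pow_add, ← mul_assoc (1 - _), ← hn, ← hβ, ← pow_succ',
        show d * n + (d * n * k + r) = d * n * (k + 1) + r by ring] at this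
  have hdk : d * n * k ≤ s := by
    refine le_trans ?_ hs
    rw [sq]
    exact Nat.mul_le_mul_right _ (Nat.mul_le_mul_right _ hdn)
  obtain ⟨a, ha⟩ := hosc (s - d * n * k) k
  rw [Nat.add_sub_cancel' hdk] at ha
  obtain ⟨q, rfl⟩ := hp d hd0 hdn
  have h1 := ha i hiC
  have h2 : (M ^ (s + d * q) *ᵥ x) i ∈ Set.Icc a (a + (1 - β) ^ k * (2 * W)) := by
    rw [add_comm s, pow_add, ← Matrix.mulVec_mulVec]
    exact ⟨le_mulVec_apply (pow_mem hM _) fun j hj => (ha j (hclosed q i hiC j hj)).1,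
      mulVec_apply_le (pow_mem hM _) fun j hj => (ha j (hclosed q i hiC j hj)).2⟩
  rw [abs_le]
  constructor <;> linarith [h1.1, h1.2, h2.1, h2.2]

open Classical in
/-- The probability of not having reached a recurrent state decays geometrically. -/
theorem pow_mulVec_indicator_le (hM : M ∈ rowStochastic 𝕜 ι) {α : 𝕜} (hα : 0 ≤ α) (hα1 : α ≤ 1)
    (hmin : ∀ i j, 0 < M i j → α ≤ M i j) (k : ℕ) (i : ι) :
    (M ^ ((Fintype.card ι) ^ 2 * k) *ᵥ fun j => if M.IsRecurrent j then 0 else 1) i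
      ≤ (1 - α ^ (Fintype.card ι) ^ 2) ^ k := by
  set n := Fintype.card ι with hn
  set τ : ι → 𝕜 := fun j => if M.IsRecurrent j then 0 else 1 with hτ
  have hβ : (0 : 𝕜) ≤ 1 - α ^ n ^ 2 := sub_nonneg.2 (pow_le_one₀ hα hα1)
  have hτ1 : ∀ j, τ j ≤ 1 := fun j => by simp only [hτ]; split_ifs <;> simp
  have step : ∀ j, (M ^ n ^ 2 *ᵥ τ) j ≤ (1 - α ^ n ^ 2) * τ j := by
    intro j
    by_cases hj : M.IsRecurrent j
    · simp only [hτ, if_pos hj, mul_zero]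
      refine mulVec_apply_le (pow_mem hM _) fun l hl => ?_
      rw [if_pos (hj.of_pos hM hl)]
    · obtain ⟨l, k, hk, hl⟩ := exists_isRecurrent hM j
      obtain ⟨r, hr, hr'⟩ := exists_lt_pow_apply_pos hM hk
      obtain ⟨x, hx⟩ := exists_apply_pos (pow_mem hM (n ^ 2 - r)) l
      have hrn : r ≤ n ^ 2 := hr.le.trans (Nat.le_self_pow two_ne_zero _)
      have hpos := pow_add_apply_pos hM hr' hx
      rw [Nat.add_sub_cancel' hrn] at hpos
      have hxrec : M.IsRecurrent x := hl.of_pos hM hx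
      have hle := pow_le_pow_apply hM hα hmin _ _ _ hpos
      simp only [hτ, if_neg hj, mul_one]
      calc (M ^ n ^ 2 *ᵥ τ) j = ∑ y, (M ^ n ^ 2) j y * τ y := rfl
        _ ≤ ∑ y, ((M ^ n ^ 2) j y - if y = x then (M ^ n ^ 2) j y else 0) := by
          refine Finset.sum_le_sum fun y _ => ?_
          split_ifs with hy
          · subst hy; simp [hτ, hxrec]
          · simpa using mul_le_of_le_one_right (rowStochastic_pow_apply_nonneg hM _ _ _) (hτ1 y)
        _ = 1 - (M ^ n ^ 2) j x := by
          rw [Finset.sum_sub_distrib, sum_row_of_mem_rowStochastic (pow_mem hM _)]; simp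
        _ ≤ 1 - α ^ n ^ 2 := by linarith
  suffices h : ∀ j, (M ^ (n ^ 2 * k) *ᵥ τ) j ≤ (1 - α ^ n ^ 2) ^ k * τ j from
    (h i).trans (mul_le_of_le_one_right (pow_nonneg hβ _) (hτ1 i))
  induction k with
  | zero => simp
  | succ k ih =>
    intro j
    have hmono : (M ^ (n ^ 2) *ᵥ (M ^ (n ^ 2 * k) *ᵥ τ)) j
        ≤ (M ^ (n ^ 2) *ᵥ fun j => (1 - α ^ n ^ 2) ^ k * τ j) j :=
      Finset.sum_le_sum fun l _ => mul_le_mul_of_nonneg_left (ih l)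
        (rowStochastic_pow_apply_nonneg hM _ _ _)
    rw [Matrix.mulVec_mulVec, ← pow_add, show n ^ 2 + n ^ 2 * k = n ^ 2 * (k + 1) by ring] at hmono
    refine hmono.trans ?_
    have : (fun j => (1 - α ^ n ^ 2) ^ k * τ j) = (1 - α ^ n ^ 2) ^ k • τ := rfl
    rw [this, Matrix.mulVec_smul, Pi.smul_apply, smul_eq_mul, pow_succ _ k, mul_assoc]
    exact mul_le_mul_of_nonneg_left (step j) (pow_nonneg hβ _)

/-- The expectations `M ^ t *ᵥ x` become `p`-periodic at a geometric rate, if `p` is a multiple of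
all numbers up to the number of states: half of the time is spent on getting to the recurrent
states and the other half on mixing there. -/
theorem abs_pow_add_mulVec_sub_le (hM : M ∈ rowStochastic 𝕜 ι) {α : 𝕜} (hα : 0 ≤ α)
    (hα1 : α ≤ 1) (hmin : ∀ i j, 0 < M i j → α ≤ M i j) {p : ℕ}
    (hp : ∀ d, 0 < d → d ≤ Fintype.card ι → d ∣ p) {x : ι → 𝕜} {W : 𝕜} (hx : ∀ j, |x j| ≤ W)
    {t k : ℕ} (ht : 2 * (Fintype.card ι) ^ 2 * k ≤ t) (i : ι) :
    |(M ^ (t + p) *ᵥ x) i - (M ^ t *ᵥ x) i| ≤ 4 * W * (1 - α ^ (Fintype.card ι) ^ 2) ^ k := by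
  classical
  set n := Fintype.card ι with hn
  set q : 𝕜 := 1 - α ^ n ^ 2 with hq
  have hq0 : 0 ≤ q := sub_nonneg.2 (pow_le_one₀ hα hα1)
  have hW : 0 ≤ W := (abs_nonneg _).trans (hx i)
  obtain ⟨s, rfl⟩ : ∃ s, t = n ^ 2 * k + s := ⟨t - n ^ 2 * k, by
    have : n ^ 2 * k ≤ t := le_trans (by nlinarith [Nat.zero_le (n ^ 2 * k)]) ht
    omega⟩
  have hs : n ^ 2 * k ≤ s := by nlinarith
  set τ : ι → 𝕜 := fun j => if M.IsRecurrent j then 0 else 1 with hτ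
  set g : ι → 𝕜 := fun j => (M ^ (s + p) *ᵥ x) j - (M ^ s *ᵥ x) j with hg
  have hgj : ∀ j, |g j| ≤ 2 * W * q ^ k + 2 * W * τ j := by
    intro j
    by_cases hj : M.IsRecurrent j
    · simpa [hτ, hj] using hj.abs_pow_add_mulVec_sub_le hM hα hα1 hmin hp hx hs
    · have h1 := abs_mulVec_apply_le (pow_mem hM (s + p)) hx j
      have h2 := abs_mulVec_apply_le (pow_mem hM s) hx j
      have h3 := abs_sub ((M ^ (s + p) *ᵥ x) j) ((M ^ s *ᵥ x) j)
      have : 0 ≤ 2 * W * q ^ k := by positivity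
      simp only [hτ, if_neg hj, hg]
      linarith
  have heq : (M ^ (n ^ 2 * k + s + p) *ᵥ x) i - (M ^ (n ^ 2 * k + s) *ᵥ x) i
      = ∑ j, (M ^ (n ^ 2 * k)) i j * g j := by
    rw [add_assoc, pow_add, pow_add M _ s, ← Matrix.mulVec_mulVec, ← Matrix.mulVec_mulVec,
      ← Pi.sub_apply, ← Matrix.mulVec_sub]
    rfl
  rw [heq]
  calc |∑ j, (M ^ (n ^ 2 * k)) i j * g j|
      ≤ ∑ j, |(M ^ (n ^ 2 * k)) i j * g j| := Finset.abs_sum_le_sum_abs _ _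
    _ ≤ ∑ j, ((M ^ (n ^ 2 * k)) i j * (2 * W * q ^ k)
          + 2 * W * ((M ^ (n ^ 2 * k)) i j * τ j)) := by
      refine Finset.sum_le_sum fun j _ => ?_
      rw [abs_mul, abs_of_nonneg (rowStochastic_pow_apply_nonneg hM _ _ _)]
      have := mul_le_mul_of_nonneg_left (hgj j) (rowStochastic_pow_apply_nonneg hM (n ^ 2 * k) i j)
      linarith
    _ = 2 * W * q ^ k + 2 * W * (M ^ (n ^ 2 * k) *ᵥ τ) i := by
      rw [Finset.sum_add_distrib, ← Finset.sum_mul, ← Finset.mul_sum,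
        sum_row_of_mem_rowStochastic (pow_mem hM _), one_mul]
      rfl
    _ ≤ 4 * W * q ^ k := by
      have := mul_le_mul_of_nonneg_left (pow_mulVec_indicator_le hM hα hα1 hmin k i)
        (by positivity : 0 ≤ 2 * W)
      rw [← hq] at this
      linarith

end Matrix

/-! ### Sequences that become periodic up to a geometric error -/

section Sequences

theorem sum_range_mul_div {𝕜 : Type*} [Semiring 𝕜] {m : ℕ} (hm : 0 < m) (q : 𝕜) (j : ℕ) :
    ∑ i ∈ Finset.range (m * j), q ^ (i / m) = m * ∑ l ∈ Finset.range j, q ^ l := by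
  induction j with
  | zero => simp
  | succ j ih =>
    rw [Nat.mul_succ, Finset.sum_range_add, ih, Finset.sum_range_succ, mul_add]
    congr 1
    rw [Finset.sum_congr rfl (g := fun _ => q ^ j)]
    · simp
    · intro i hi
      rw [Nat.mul_add_div hm, Nat.div_eq_of_lt (Finset.mem_range.1 hi), add_zero]

variable {𝕜 : Type*} [Field 𝕜] [LinearOrder 𝕜] [IsStrictOrderedRing 𝕜]

theorem sum_range_pow_le {q : 𝕜} (hq0 : 0 ≤ q) (hq1 : q < 1) (j : ℕ) :
    ∑ l ∈ Finset.range j, q ^ l ≤ 1 / (1 - q) := by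
  have h := geom_sum_mul_neg q j
  rw [le_div_iff₀ (sub_pos.2 hq1), h]
  linarith [pow_nonneg hq0 j]

/-- A sequence with increments `≤ D * q ^ (t / m)` changes after time `f + m * k` so little that
even `f + 1` times the change is small: `(f + 1) * q ^ (f / m)` is bounded. -/
theorem mul_abs_sub_le_of_abs_succ_sub_le {a : ℕ → 𝕜} {D q : 𝕜} {m : ℕ} (hm : 0 < m)
    (hq0 : 0 ≤ q) (hq1 : q < 1) (hD : 0 ≤ D) (ha : ∀ t, |a (t + 1) - a t| ≤ D * q ^ (t / m))
    (f k j : ℕ) :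
    ((f : 𝕜) + 1) * |a (f + m * k + j) - a (f + m * k)| ≤ D * q ^ k * (m / (1 - q)) ^ 2 := by
  have h1q : 0 < 1 - q := sub_pos.2 hq1
  have htail : ∀ j, |a (f + m * k + j) - a (f + m * k)|
      ≤ ∑ i ∈ Finset.range j, D * q ^ k * q ^ (f / m) * q ^ (i / m) := by
    intro j
    induction j with
    | zero => simp
    | succ j ih =>
      rw [Finset.sum_range_succ]
      have h1 := ha (f + m * k + j)
      have h2 : q ^ ((f + m * k + j) / m) ≤ q ^ k * q ^ (f / m) * q ^ (j / m) := by
        rw [← pow_add, ← pow_add]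
        refine pow_le_pow_of_le_one hq0 hq1.le ?_
        rw [show f + m * k + j = f + j + m * k by ring, Nat.add_mul_div_left _ _ hm]
        have : f / m + j / m ≤ (f + j) / m := Nat.div_add_div_le_add_div
        omega
      have h3 := mul_le_mul_of_nonneg_left h2 hD
      have h4 := abs_sub_le (a (f + m * k + (j + 1))) (a (f + m * k + j)) (a (f + m * k))
      rw [← add_assoc] at h4 ⊢
      linarith
  have hsum : ∑ i ∈ Finset.range j, q ^ (i / m) ≤ m / (1 - q) := by
    calc ∑ i ∈ Finset.range j, q ^ (i / m) ≤ ∑ i ∈ Finset.range (m * j), q ^ (i / m) :=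
          Finset.sum_le_sum_of_subset_of_nonneg
            (Finset.range_subset_range.2 (Nat.le_mul_of_pos_left j hm))
            fun _ _ _ => pow_nonneg hq0 _
      _ ≤ m * (1 / (1 - q)) := by
          rw [sum_range_mul_div hm]
          exact mul_le_mul_of_nonneg_left (sum_range_pow_le hq0 hq1 j) (Nat.cast_nonneg m)
      _ = m / (1 - q) := by ring
  -- `(l + 1) * q ^ l ≤ 1 + q + ⋯ + q ^ l`
  have hf : ((f : 𝕜) + 1) * q ^ (f / m) ≤ m / (1 - q) := by
    have h1 : ((f / m : ℕ) + 1 : 𝕜) * q ^ (f / m) ≤ 1 / (1 - q) := by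
      refine le_trans ?_ (sum_range_pow_le hq0 hq1 (f / m + 1))
      have := Finset.card_nsmul_le_sum (Finset.range (f / m + 1)) (fun l => q ^ l) (q ^ (f / m))
        fun l hl => pow_le_pow_of_le_one hq0 hq1.le (Nat.lt_succ_iff.1 (Finset.mem_range.1 hl))
      simpa using this
    have h2 : (f : 𝕜) + 1 ≤ m * ((f / m : ℕ) + 1) := by
      have := Nat.lt_mul_div_succ f hm
      exact_mod_cast this
    calc ((f : 𝕜) + 1) * q ^ (f / m) ≤ m * ((f / m : ℕ) + 1) * q ^ (f / m) :=
          mul_le_mul_of_nonneg_right h2 (pow_nonneg hq0 _)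
      _ = m * (((f / m : ℕ) + 1) * q ^ (f / m)) := by ring
      _ ≤ m * (1 / (1 - q)) := mul_le_mul_of_nonneg_left h1 (Nat.cast_nonneg m)
      _ = m / (1 - q) := by ring
  calc ((f : 𝕜) + 1) * |a (f + m * k + j) - a (f + m * k)|
      ≤ (f + 1) * ∑ i ∈ Finset.range j, D * q ^ k * q ^ (f / m) * q ^ (i / m) :=
        mul_le_mul_of_nonneg_left (htail j) (by positivity)
    _ = D * q ^ k * (((f + 1) * q ^ (f / m)) * ∑ i ∈ Finset.range j, q ^ (i / m)) := by
        rw [← Finset.mul_sum]; ring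
    _ ≤ D * q ^ k * (m / (1 - q) * (m / (1 - q))) := by
        refine mul_le_mul_of_nonneg_left (mul_le_mul hf hsum ?_ ?_) (by positivity)
        · exact Finset.sum_nonneg fun _ _ => pow_nonneg hq0 _
        · positivity
    _ = D * q ^ k * (m / (1 - q)) ^ 2 := by ring

/-- The value at `T` of the chord of `u` over `[s, t]`. -/
def chord (u : ℕ → 𝕜) (T : 𝕜) (s t : ℕ) : 𝕜 := u s + (T - s) * (u t - u s) / (t - s)

/-- If the increments of `u` over `p` steps are `p * a` up to the error `η`, then so are those over
`k * p` steps up to `k * η`. -/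
theorem mul_abs_add_mul_sub_le {u : ℕ → 𝕜} {x a η : 𝕜} {p B : ℕ} (hx : 0 ≤ x)
    (h : ∀ s, B ≤ s → x * |u (s + p) - u s - p * a| ≤ η) {t : ℕ} (ht : B ≤ t) (k : ℕ) :
    x * |u (t + k * p) - u t - k * p * a| ≤ k * η := by
  induction k with
  | zero => simp
  | succ k ih =>
    have h1 := h (t + k * p) (by omega)
    have h2 := abs_add_le (u (t + k * p + p) - u (t + k * p) - p * a)
      (u (t + k * p) - u t - k * p * a)
    have h3 := mul_le_mul_of_nonneg_left h2 hx
    rw [show t + (k + 1) * p = t + k * p + p by ring]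
    have h4 : u (t + k * p + p) - u t - ((k + 1 : ℕ) : 𝕜) * p * a
      = u (t + k * p + p) - u (t + k * p) - p * a + (u (t + k * p) - u t - k * p * a) := by
      push_cast; ring
    rw [h4]
    push_cast
    linarith

end Sequences

/-! ### The value as the lower convex envelope of the utilities -/

section Envelope

variable {u : ℕ → ℝ} {W T : ℝ}

theorem summable_mul_of_abs_le (hu : ∀ t, |u t| ≤ W * (t + 1)) {δ : ℕ → ℝ}
    (hδ : IsStoppingTimeDistribution δ) (hT : HasExpectedTime δ T) :
    Summable fun t => δ t * u t := by
  refine Summable.of_norm_bounded (g := fun t : ℕ => W * (t * δ t + δ t))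
    ((hT.summable.add hδ.2.summable).mul_left W) fun t => ?_
  rw [Real.norm_eq_abs, abs_mul, abs_of_nonneg (hδ.1 t).1]
  have := mul_le_mul_of_nonneg_left (hu t) (hδ.1 t).1
  linarith

/-- If all chords of `u` over `T` lie above `v`, then a line through `(T, v)` lies below `u`. -/
theorem exists_line_le (hT : 0 ≤ T) (hstep : ∀ t, u 0 - W * t ≤ u t) {v : ℝ}
    (h : ∀ s t : ℕ, (s : ℝ) ≤ T → T < t → v ≤ chord u T s t) :
    ∃ c, ∀ t : ℕ, v + c * (t - T) ≤ u t := by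
  have heq : ∀ s : ℕ, (s : ℝ) = T → v ≤ u s := by
    intro s hs
    obtain ⟨t, ht⟩ := exists_nat_gt T
    simpa [chord, hs] using h s t hs.le ht
  rcases hT.eq_or_lt with rfl | hT
  · refine ⟨-W, fun t => ?_⟩
    have := heq 0 (by simp)
    have := hstep t
    linarith
  obtain ⟨c, hc, hc'⟩ := exists_between_of_forall_le
    (s := {x | ∃ s : ℕ, (s : ℝ) < T ∧ x = (v - u s) / (T - s)})
    (t := {x | ∃ t : ℕ, T < t ∧ x = (u t - v) / (t - T)})
    ⟨_, 0, by simpa using hT, rfl⟩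
    (by obtain ⟨t, ht⟩ := exists_nat_gt T; exact ⟨_, t, ht, rfl⟩) (by
      rintro _ ⟨s, hs, rfl⟩ _ ⟨t, ht, rfl⟩
      have h1 := h s t hs.le ht
      rw [chord, ← sub_le_iff_le_add', le_div_iff₀ (by linarith)] at h1
      rw [div_le_div_iff₀ (by linarith) (by linarith)]
      nlinarith)
  refine ⟨c, fun t => ?_⟩
  rcases lt_trichotomy (t : ℝ) T with ht | ht | ht
  · have := hc ⟨t, ht, rfl⟩
    rw [div_le_iff₀ (by linarith)] at this
    linarith
  · rw [ht]; simpa using heq t ht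
  · have := hc' ⟨t, ht, rfl⟩
    rw [le_div_iff₀ (by linarith)] at this
    linarith

theorem le_tsum_mul_of_line_le (hu : ∀ t, |u t| ≤ W * (t + 1)) {v c : ℝ}
    (hline : ∀ t : ℕ, v + c * (t - T) ≤ u t) {δ : ℕ → ℝ}
    (hδ : IsStoppingTimeDistribution δ) (hT : HasExpectedTime δ T) :
    v ≤ ∑' t, δ t * u t := by
  have h1 : HasSum (fun t : ℕ => δ t * (v + c * (t - T))) v := by
    have := (hδ.2.mul_left (v - c * T)).add (hT.mul_left c)
    rw [show (v - c * T) * 1 + c * T = v by ring] at this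
    exact this.congr_fun fun t => by ring
  refine hasSum_le (fun t => ?_) h1 (summable_mul_of_abs_le hu hδ hT).hasSum
  exact mul_le_mul_of_nonneg_left (hline t) (hδ.1 t).1

/-- The two-point distribution on `{s, t}` with mean `T` attains the chord. -/
theorem exists_tsum_mul_eq_chord (u : ℕ → ℝ) {s t : ℕ} (hs : (s : ℝ) ≤ T) (ht : T < t) :
    ∃ δ : ℕ → ℝ, IsStoppingTimeDistribution δ ∧ HasExpectedTime δ T ∧
      chord u T s t = ∑' r, δ r * u r := by
  have hst : (0 : ℝ) < t - s := by linarith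
  have hne : s ≠ t := by rintro rfl; linarith
  set b : ℝ := (T - s) / (t - s) with hb
  have hb0 : 0 ≤ b := div_nonneg (by linarith) hst.le
  have hb1 : b ≤ 1 := by rw [hb, div_le_one hst]; linarith
  let δ : ℕ → ℝ := fun r => if r = s then 1 - b else if r = t then b else 0
  have key : ∀ f : ℕ → ℝ, HasSum (fun r => δ r * f r) ((1 - b) * f s + b * f t) := by
    intro f
    have h := hasSum_sum_of_ne_finset_zero (L := .unconditional ℕ) (f := fun r => δ r * f r)
      (s := {s, t}) (by
      intro r hr
      simp only [Finset.mem_insert, Finset.mem_singleton, not_or] at hr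
      simp [δ, hr.1, hr.2])
    rw [Finset.sum_pair hne] at h
    simpa [δ, hne.symm] using h
  refine ⟨δ, ⟨fun r => ?_, ?_⟩, ?_, ?_⟩
  · simp only [δ]
    split_ifs
    · exact ⟨by linarith, by linarith⟩
    · exact ⟨hb0, hb1⟩
    · simp
  · simpa using key fun _ => 1
  · have := key fun r => r
    unfold HasExpectedTime
    convert this using 1
    · ext r; ring
    · rw [hb]; field_simp; ring
  · rw [(key u).tsum_eq, chord, hb]; field_simp; ring

end Envelope

/-- Truncating the horizon. Beyond `B` the increments of `u` over `p` steps are `p * a`, up to an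
error that is small even when multiplied by `T`. A chord that ends beyond `B + p` lies between a
chord with an end in `(B, B + p]` and a ray of slope `a`. -/
theorem sub_le_chord {u : ℕ → ℝ} {T ε a v : ℝ} {p B : ℕ} (hp : 0 < p) (hε : 0 ≤ ε)
    (hB : T < B + 1)
    (hper : ∀ s, B ≤ s → T * |u (s + p) - u s - p * a| ≤ ε)
    (hray : ∀ s : ℕ, (s : ℝ) ≤ T → v ≤ u s + (T - s) * a)
    (hchord : ∀ s t : ℕ, (s : ℝ) ≤ T → T < t → t ≤ B + p → v ≤ chord u T s t)
    {s t : ℕ} (hs : (s : ℝ) ≤ T) (ht : T < t) : v - ε ≤ chord u T s t := by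
  rcases le_or_gt t (B + p) with htB | htB
  · linarith [hchord s t hs ht htB]
  obtain ⟨t₀, k, ht₀, ht₀', rfl⟩ : ∃ t₀ k, B < t₀ ∧ t₀ ≤ B + p ∧ t = t₀ + k * p := by
    refine ⟨B + 1 + (t - B - 1) % p, (t - B - 1) / p, by omega, ?_, ?_⟩
    · have := Nat.mod_lt (t - B - 1) hp; omega
    · have := Nat.mod_add_div' (t - B - 1) p; omega
  have hs0 : (0 : ℝ) ≤ s := Nat.cast_nonneg s
  have hp1 : (1 : ℝ) ≤ p := by exact_mod_cast hp
  have hk0 : (0 : ℝ) ≤ k := Nat.cast_nonneg k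
  have ht₀B : (B : ℝ) + 1 ≤ t₀ := by exact_mod_cast ht₀
  have h1 := hchord s t₀ hs (by linarith) ht₀'
  have h2 := hray s hs
  have h3 := mul_abs_add_mul_sub_le (x := T) (a := a) (η := ε) (u := u) (p := p) (by linarith) hper
    ht₀.le k
  have h4 : (T - s) * |u (t₀ + k * p) - u t₀ - k * p * a| ≤ k * ε :=
    (mul_le_mul_of_nonneg_right (by linarith) (abs_nonneg _)).trans h3
  have h5 : -(k * ε) ≤ (T - s) * (u (t₀ + k * p) - u t₀ - k * p * a) := by
    have := mul_le_mul_of_nonneg_left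
      (neg_abs_le (u (t₀ + k * p) - u t₀ - k * p * a)) (sub_nonneg.2 hs)
    linarith
  rw [chord, ← sub_le_iff_le_add', le_div_iff₀ (by linarith)] at h1 ⊢
  have h6 : (v - u s) * (k * p) ≤ ((T - s) * a) * (k * p) :=
    mul_le_mul_of_nonneg_right (by linarith) (by positivity)
  have h7 : k * ε ≤ ε * (t₀ + k * p - s) := by
    have : k ≤ (t₀ + k * p - s : ℝ) := by nlinarith
    nlinarith
  push_cast
  nlinarith

/-- Chords from `s` approach the ray of slope `a`. -/
theorem le_ray_of_forall_le_chord {u : ℕ → ℝ} {T ε a v : ℝ} {p B : ℕ} (hp : 0 < p)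
    (hB : T < B + 1)
    (hper : ∀ s, B ≤ s → T * |u (s + p) - u s - p * a| ≤ ε)
    {s : ℕ} (hs : (s : ℝ) ≤ T) (h : ∀ t : ℕ, T < t → v ≤ chord u T s t) :
    v ≤ u s + (T - s) * a + ε := by
  have hs0 : (0 : ℝ) ≤ s := Nat.cast_nonneg s
  have hp1 : (1 : ℝ) ≤ p := by exact_mod_cast hp
  have hε : 0 ≤ ε := le_trans (mul_nonneg (by linarith) (abs_nonneg _)) (hper B le_rfl)
  have key : ∀ k : ℕ, (k : ℝ) * ((v - u s) * p - (T - s) * p * a - ε)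
      ≤ (T - s) * (u (B + 1) - u s) - (v - u s) * (B + 1 - s) := by
    intro k
    have hk0 : (0 : ℝ) ≤ k := Nat.cast_nonneg k
    have hkp : (0 : ℝ) ≤ k * p := by positivity
    have h1 := h (B + 1 + k * p) (by push_cast; linarith)
    have h3 := mul_abs_add_mul_sub_le (x := T) (a := a) (η := ε) (u := u) (p := p) (by linarith)
      hper (Nat.le_succ B) k
    have h4 : (T - s) * |u (B + 1 + k * p) - u (B + 1) - k * p * a| ≤ k * ε :=
      (mul_le_mul_of_nonneg_right (by linarith) (abs_nonneg _)).trans h3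
    have h5 := mul_le_mul_of_nonneg_left
      (le_abs_self (u (B + 1 + k * p) - u (B + 1) - k * p * a)) (sub_nonneg.2 hs)
    rw [chord, ← sub_le_iff_le_add', le_div_iff₀ (by push_cast; linarith)] at h1
    push_cast at h1
    linarith
  have hle : (v - u s) * p - (T - s) * p * a - ε ≤ 0 := by
    by_contra! hpos
    obtain ⟨k, hk⟩ := exists_nat_gt (((T - s) * (u (B + 1) - u s) - (v - u s) * (B + 1 - s))
      / ((v - u s) * p - (T - s) * p * a - ε))
    rw [div_lt_iff₀ hpos] at hk
    linarith [key k]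
  have : (v - u s - (T - s) * a) * p ≤ ε * p := by nlinarith
  linarith [le_of_mul_le_mul_right this (by linarith)]

namespace MarkovChain

variable {n : ℕ} (C : MarkovChain n)

theorem pos (C : MarkovChain n) : 0 < n := by
  obtain ⟨p, -⟩ := C.exists_pos
  exact p.1.pos

theorem minProb_le {i j : Fin n} (h : 0 < C.M i j) : C.minProb ≤ C.M i j :=
  Finset.inf'_le (f := fun p : Fin n × Fin n => C.M p.1 p.2) (b := (i, j)) (by simpa using h)

theorem exists_eq_minProb : ∃ i j, 0 < C.M i j ∧ C.M i j = C.minProb := by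
  obtain ⟨p, hp, h⟩ := Finset.exists_mem_eq_inf' C.exists_pos fun p : Fin n × Fin n => C.M p.1 p.2
  exact ⟨p.1, p.2, by simpa using hp, h.symm⟩

theorem minProb_pos : 0 < C.minProb := by
  obtain ⟨i, j, h, h'⟩ := C.exists_eq_minProb
  rwa [← h']

theorem minProb_le_one : C.minProb ≤ 1 := by
  obtain ⟨i, j, -, h'⟩ := C.exists_eq_minProb
  rw [← h']
  exact Matrix.le_one_of_mem_rowStochastic C.stochastic

/-- A row with an entry other than `0` and `1` has two positive entries. -/
theorem minProb_le_half (h : C.minProb ≠ 1) : 2 * C.minProb ≤ 1 ∧ 2 ≤ n := by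
  obtain ⟨i, j, hpos, hij⟩ := C.exists_eq_minProb
  have hsum := Matrix.sum_row_of_mem_rowStochastic C.stochastic i
  rw [← Finset.add_sum_erase _ _ (Finset.mem_univ j)] at hsum
  have hlt := C.minProb_le_one.lt_of_ne h
  have hs : 0 < ∑ x ∈ Finset.univ.erase j, C.M i x := by linarith
  obtain ⟨x, hx, hx'⟩ := Finset.exists_lt_of_sum_lt (s := Finset.univ.erase j)
    (f := fun _ => (0 : ℚ)) (g := fun x => C.M i x) (by simpa only [Finset.sum_const_zero] using hs)
  have h1 := C.minProb_le hx'
  have h2 := Finset.single_le_sum (f := fun x => C.M i x)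
    (fun y _ => Matrix.nonneg_of_mem_rowStochastic C.stochastic) hx
  refine ⟨by linarith, ?_⟩
  have hne : x ≠ j := Finset.ne_of_mem_erase hx
  have := Finset.card_le_univ ({x, j} : Finset (Fin n))
  rwa [Finset.card_pair hne, Fintype.card_fin] at this

/-- The expected weight at time `t`. -/
def income (t : ℕ) : ℚ := (C.μ ᵥ* C.M ^ t) ⬝ᵥ C.w

theorem utility_succ (t : ℕ) : C.utility (t + 1) = C.utility t + C.income (t + 1) := by
  rw [utility, Finset.sum_range_succ]; rfl

theorem income_eq (t : ℕ) : C.income t = C.μ ⬝ᵥ (C.M ^ t *ᵥ C.w) := by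
  rw [income, Matrix.dotProduct_mulVec]

theorem abs_dotProduct_μ_le {x : Fin n → ℚ} {b : ℚ} (hx : ∀ i, |x i| ≤ b) : |C.μ ⬝ᵥ x| ≤ b := by
  calc |C.μ ⬝ᵥ x| ≤ ∑ i, |C.μ i * x i| := Finset.abs_sum_le_sum_abs _ _
    _ ≤ ∑ i, C.μ i * b := by
      refine Finset.sum_le_sum fun i _ => ?_
      rw [abs_mul, abs_of_nonneg (C.initial.1 i)]
      exact mul_le_mul_of_nonneg_left (hx i) (C.initial.1 i)
    _ = b := by rw [← Finset.sum_mul, C.initial.2, one_mul]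

variable {C} {W : ℚ}

theorem abs_income_le (hW : ∀ i, |C.w i| ≤ W) (t : ℕ) : |C.income t| ≤ W := by
  rw [income_eq]
  exact C.abs_dotProduct_μ_le (Matrix.abs_mulVec_apply_le (pow_mem C.stochastic t) hW)

theorem abs_utility_le (hW : ∀ i, |C.w i| ≤ W) (t : ℕ) : |C.utility t| ≤ W * (t + 1) := by
  refine (Finset.abs_sum_le_sum_abs _ _).trans ?_
  refine (Finset.sum_le_card_nsmul _ _ W fun i _ => abs_income_le hW i).trans ?_
  simp [mul_comm]

theorem utility_zero_sub_le (hW : ∀ i, |C.w i| ≤ W) (t : ℕ) :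
    C.utility 0 - W * t ≤ C.utility t := by
  induction t with
  | zero => simp
  | succ t ih =>
    rw [utility_succ]
    have := neg_le_of_abs_le (abs_income_le hW (t + 1))
    push_cast
    linarith

theorem abs_income_add_sub_le (hW : ∀ i, |C.w i| ≤ W) {p : ℕ} (hp : ∀ d, 0 < d → d ≤ n → d ∣ p)
    (t : ℕ) : |C.income (t + p) - C.income t|
      ≤ 4 * W * (1 - C.minProb ^ n ^ 2) ^ (t / (2 * n ^ 2)) := by
  rw [income_eq, income_eq, ← dotProduct_sub]
  refine C.abs_dotProduct_μ_le fun i => ?_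
  have := Matrix.abs_pow_add_mulVec_sub_le C.stochastic C.minProb_pos.le C.minProb_le_one
    (fun i j => C.minProb_le) (p := p) (by simpa using hp) hW (t := t) (k := t / (2 * n ^ 2))
    (by simpa using Nat.mul_div_le t (2 * n ^ 2)) i
  simpa using this

theorem mul_abs_utility_add_sub_le (hW : ∀ i, |C.w i| ≤ W) {p : ℕ}
    (hp : ∀ d, 0 < d → d ≤ n → d ∣ p) (f k s : ℕ) (hs : f + 2 * n ^ 2 * k ≤ s) :
    ((f : ℚ) + 1) * |(C.utility (s + p) - C.utility s)
        - (C.utility (f + 2 * n ^ 2 * k + p) - C.utility (f + 2 * n ^ 2 * k))|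
      ≤ 4 * W * (1 - C.minProb ^ n ^ 2) ^ k * ((2 * n ^ 2 : ℕ) / C.minProb ^ n ^ 2) ^ 2 := by
  obtain ⟨j, rfl⟩ := Nat.exists_eq_add_of_le hs
  have hβ0 : 0 < C.minProb ^ n ^ 2 := pow_pos C.minProb_pos _
  have hβ1 : C.minProb ^ n ^ 2 ≤ 1 := pow_le_one₀ C.minProb_pos.le C.minProb_le_one
  have hW0 : 0 ≤ W := (abs_nonneg _).trans (hW ⟨0, C.pos⟩)
  have hn := C.pos
  have := mul_abs_sub_le_of_abs_succ_sub_le (a := fun t => C.utility (t + p) - C.utility t)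
    (D := 4 * W) (q := 1 - C.minProb ^ n ^ 2) (m := 2 * n ^ 2) (by positivity) (by linarith)
    (by linarith) (by linarith) (fun t => ?_) f k j
  · simpa using this
  · have h1 := abs_income_add_sub_le hW hp (t + 1)
    have h2 : (1 - C.minProb ^ n ^ 2) ^ ((t + 1) / (2 * n ^ 2))
        ≤ (1 - C.minProb ^ n ^ 2) ^ (t / (2 * n ^ 2)) :=
      pow_le_pow_of_le_one (by linarith) (by linarith) (Nat.div_le_div_right (Nat.le_succ t))
    have h3 := mul_le_mul_of_nonneg_left h2 (by linarith : 0 ≤ 4 * W)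
    rw [show t + 1 + p = t + p + 1 by ring, utility_succ, utility_succ]
    rw [show t + 1 + p = t + p + 1 by ring] at h1
    refine le_trans (le_of_eq ?_) (h1.trans h3)
    congr 1; ring

variable (C)

theorem exists_abs_w_le : ∀ i, |C.w i| ≤ ∑ j, |C.w j| := fun i =>
  Finset.single_le_sum (f := fun j => |C.w j|) (fun _ _ => abs_nonneg _) (Finset.mem_univ i)

theorem abs_utility_cast_le (t : ℕ) :
    |(C.utility t : ℝ)| ≤ ((∑ j, |C.w j| : ℚ) : ℝ) * (t + 1) := by
  exact_mod_cast abs_utility_le C.exists_abs_w_le t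

theorem le_val {T v : ℝ} (hT : 0 ≤ T)
    (h : ∀ s t : ℕ, (s : ℝ) ≤ T → T < t → v ≤ chord (fun t => (C.utility t : ℝ)) T s t) :
    v ≤ C.val T := by
  obtain ⟨c, hc⟩ := exists_line_le (u := fun t => (C.utility t : ℝ))
    (W := ((∑ j, |C.w j| : ℚ) : ℝ)) hT
    (fun t => by exact_mod_cast utility_zero_sub_le C.exists_abs_w_le t) h
  obtain ⟨t, ht⟩ := exists_nat_gt T
  obtain ⟨δ, h1, h2, h3⟩ := exists_tsum_mul_eq_chord (fun t => (C.utility t : ℝ)) (s := 0)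
    (by simpa using hT) ht
  refine le_csInf ⟨_, δ, h1, h2, h3⟩ ?_
  rintro _ ⟨δ, h1, h2, rfl⟩
  exact le_tsum_mul_of_line_le C.abs_utility_cast_le hc h1 h2

theorem val_le_chord {T : ℝ} {s t : ℕ} (hs : (s : ℝ) ≤ T) (ht : T < t) :
    C.val T ≤ chord (fun t => (C.utility t : ℝ)) T s t := by
  refine csInf_le ?_ (exists_tsum_mul_eq_chord (fun t => (C.utility t : ℝ)) hs ht)
  -- bounded below, because `u t ≥ -W * (t + 1)`, which is a line through `(T, -W * (T + 1))`
  set W : ℝ := ((∑ j, |C.w j| : ℚ) : ℝ)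
  refine ⟨-W * (T + 1), ?_⟩
  rintro _ ⟨δ, h1, h2, rfl⟩
  refine le_tsum_mul_of_line_le (c := -W) C.abs_utility_cast_le (fun t => ?_) h1 h2
  have := neg_le_of_abs_le (C.abs_utility_cast_le t)
  linarith

/-- The least chord or ray over a long enough finite horizon approximates the value. -/
theorem abs_val_sub_le {T ε a v : ℚ} (hT : 0 ≤ T) (hε : 0 ≤ ε) {f p B : ℕ} (hf : (f : ℚ) ≤ T)
    (hf' : T < f + 1) (hp : 0 < p) (hB : f ≤ B)
    (hper : ∀ s, B ≤ s → T * |C.utility (s + p) - C.utility s - p * a| ≤ ε)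
    (hray : ∀ s ≤ f, v ≤ C.utility s + (T - s) * a)
    (hchord : ∀ s ≤ f, ∀ t, f < t → t ≤ B + p → v ≤ chord C.utility T s t)
    (hv : (∃ s ≤ f, v = C.utility s + (T - s) * a) ∨
      ∃ s ≤ f, ∃ t, f < t ∧ v = chord C.utility T s t) :
    |C.val T - v| ≤ ε := by
  have hfB : (f : ℝ) ≤ B := by exact_mod_cast hB
  have hTf : (T : ℝ) < f + 1 := by exact_mod_cast hf'
  have hfT : (f : ℝ) ≤ T := by exact_mod_cast hf
  have hle : ∀ s : ℕ, (s : ℝ) ≤ T → s ≤ f := by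
    intro s hs
    have : (s : ℝ) < f + 1 := hs.trans_lt hTf
    exact Nat.lt_succ_iff.1 (by exact_mod_cast this)
  have hlt : ∀ t : ℕ, (T : ℝ) < t → f < t := by
    intro t ht
    exact_mod_cast hfT.trans_lt ht
  have hcast : ∀ s t, ((chord C.utility T s t : ℚ) : ℝ)
      = chord (fun t => (C.utility t : ℝ)) (T : ℝ) s t := by
    intro s t
    simp [chord]
  have hper' : ∀ s, B ≤ s →
      (T : ℝ) * |(C.utility (s + p) : ℝ) - (C.utility s : ℝ) - p * (a : ℝ)| ≤ (ε : ℝ) := by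
    intro s hs
    exact_mod_cast hper s hs
  have hge : (v : ℝ) - ε ≤ C.val T := by
    refine C.le_val (by exact_mod_cast hT) fun s t hs ht => ?_
    refine sub_le_chord (a := (a : ℝ)) (B := B) hp (by exact_mod_cast hε) (by linarith) hper'
      (fun s hs => ?_) (fun s t hs ht ht' => ?_) hs ht
    · exact_mod_cast hray s (hle s hs)
    · rw [← hcast]
      exact_mod_cast hchord s (hle s hs) t (hlt t ht) ht'
  have hle' : C.val T ≤ v + ε := by
    have hε' : (0 : ℝ) ≤ ε := by exact_mod_cast hε
    rcases hv with ⟨s, hs, rfl⟩ | ⟨s, hs, t, ht, rfl⟩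
    · have hsT : (s : ℝ) ≤ T := le_trans (by exact_mod_cast hs) hfT
      have := le_ray_of_forall_le_chord (u := fun t => (C.utility t : ℝ)) (a := (a : ℝ)) (B := B)
        hp (by linarith) hper' hsT fun t ht => C.val_le_chord hsT ht
      push_cast
      exact this
    · have hsT : (s : ℝ) ≤ T := le_trans (by exact_mod_cast hs) hfT
      have htT : (T : ℝ) < t := hTf.trans_le (by exact_mod_cast ht)
      rw [hcast]
      linarith [C.val_le_chord hsT htT]
  rw [abs_le]
  constructor <;> linarith

end MarkovChain

/-! ### A program logic with step counts -/

namespace RAM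

/-- `p.WritesIdx x`: the program contains an assignment to the index register `x`. -/
def Prog.WritesIdx (x : ℕ) : Prog → Prop
  | skip => False
  | setIdx y _ => x = y
  | setReg _ _ => False
  | setArr _ _ _ => False
  | seq p q => p.WritesIdx x ∨ q.WritesIdx x
  | ite _ p q => p.WritesIdx x ∨ q.WritesIdx x
  | loop _ p => p.WritesIdx x

/-- `p.WritesReg x`: the program contains an assignment to the rational register `x`. -/
def Prog.WritesReg (x : ℕ) : Prog → Prop
  | skip => False
  | setIdx _ _ => False
  | setReg y _ => x = y
  | setArr _ _ _ => False
  | seq p q => p.WritesReg x ∨ q.WritesReg x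
  | ite _ p q => p.WritesReg x ∨ q.WritesReg x
  | loop _ p => p.WritesReg x

/-- `p.WritesArr a`: the program contains an assignment to an entry of the array `a`. -/
def Prog.WritesArr (a : ℕ) : Prog → Prop
  | skip => False
  | setIdx _ _ => False
  | setReg _ _ => False
  | setArr b _ _ => a = b
  | seq p q => p.WritesArr a ∨ q.WritesArr a
  | ite _ p q => p.WritesArr a ∨ q.WritesArr a
  | loop _ p => p.WritesArr a

/-- The states `s` and `s'` agree on everything that `p` does not assign to. -/
structure Frame (p : Prog) (s s' : State) : Prop where
  idx : ∀ x, ¬ p.WritesIdx x → s'.idx x = s.idx x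
  reg : ∀ x, ¬ p.WritesReg x → s'.reg x = s.reg x
  arr : ∀ a, ¬ p.WritesArr a → s'.arr a = s.arr a

theorem Frame.rfl {p : Prog} {s : State} : Frame p s s :=
  ⟨fun _ _ => Eq.refl _, fun _ _ => Eq.refl _, fun _ _ => Eq.refl _⟩

theorem Frame.trans {p : Prog} {s₁ s₂ s₃ : State} (h : Frame p s₁ s₂) (h' : Frame p s₂ s₃) :
    Frame p s₁ s₃ :=
  ⟨fun x hx => (h'.idx x hx).trans (h.idx x hx), fun x hx => (h'.reg x hx).trans (h.reg x hx),
    fun x hx => (h'.arr x hx).trans (h.arr x hx)⟩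

theorem Frame.mono {p q : Prog} {s s' : State} (h : Frame p s s')
    (hi : ∀ x, p.WritesIdx x → q.WritesIdx x) (hr : ∀ x, p.WritesReg x → q.WritesReg x)
    (ha : ∀ x, p.WritesArr x → q.WritesArr x) : Frame q s s' :=
  ⟨fun x hx => h.idx x (mt (hi x) hx), fun x hx => h.reg x (mt (hr x) hx),
    fun x hx => h.arr x (mt (ha x) hx)⟩

theorem Exec.frame {p : Prog} {s s' : State} {k : ℕ} (h : Exec p s k s') : Frame p s s' := by
  induction h with
  | skip => exact Frame.rfl
  | setIdx => exact ⟨fun _ hx => Function.update_of_ne hx _ _, fun _ _ => rfl, fun _ _ => rfl⟩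
  | setReg => exact ⟨fun _ _ => rfl, fun _ hx => Function.update_of_ne hx _ _, fun _ _ => rfl⟩
  | setArr => exact ⟨fun _ _ => rfl, fun _ _ => rfl, fun _ hx => Function.update_of_ne hx _ _⟩
  | seq _ _ ih₁ ih₂ =>
    exact (ih₁.mono (fun _ => Or.inl) (fun _ => Or.inl) fun _ => Or.inl).trans
      (ih₂.mono (fun _ => Or.inr) (fun _ => Or.inr) fun _ => Or.inr)
  | ite_true _ _ ih => exact ih.mono (fun _ => Or.inl) (fun _ => Or.inl) fun _ => Or.inl
  | ite_false _ _ ih => exact ih.mono (fun _ => Or.inr) (fun _ => Or.inr) fun _ => Or.inr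
  | loop_true _ _ _ ih₁ ih₂ =>
    exact Frame.trans (p := .loop _ _) (ih₁.mono (fun _ => id) (fun _ => id) fun _ => id) ih₂
  | loop_false => exact Frame.rfl

/-- Total correctness with a step bound: started in `s`, the program halts after at most `b` steps
in a state that satisfies `Q`. -/
def Runs (p : Prog) (s : State) (b : ℕ) (Q : State → Prop) : Prop :=
  ∃ k s', Exec p s k s' ∧ k ≤ b ∧ Q s'

variable {p q : Prog} {s : State} {a b c : ℕ} {Q R : State → Prop}

/-- The consequence rule, which also provides the frame condition. -/
theorem Runs.mono (h : Runs p s a R) (hab : a ≤ b) (hQ : ∀ s', R s' → Frame p s s' → Q s') :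
    Runs p s b Q := by
  obtain ⟨k, s', he, hk, hs⟩ := h
  exact ⟨k, s', he, hk.trans hab, hQ s' hs he.frame⟩

theorem Runs.seq (h : Runs p s a R) (h' : ∀ s', R s' → Frame p s s' → Runs q s' b Q) :
    Runs (.seq p q) s (a + b) Q := by
  obtain ⟨k, s₁, he, hk, hs⟩ := h
  obtain ⟨l, s₂, he', hl, hs'⟩ := h' s₁ hs he.frame
  exact ⟨k + l, s₂, he.seq he', add_le_add hk hl, hs'⟩

/-- The loop rule. The invariant is indexed by the number of rounds, which `N` bounds. -/
theorem Runs.loop {t : Test} (I : ℕ → State → Prop) (N : ℕ) (h0 : I 0 s)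
    (hstep : ∀ j s', I j s' → Frame p s s' → t.holds s' → j < N ∧ Runs p s' c (I (j + 1))) :
    Runs (.loop t p) s (N * (t.cost + c) + t.cost)
      (fun s' => ∃ j ≤ N, I j s' ∧ ¬ t.holds s') := by
  suffices H : ∀ r j s', j + r = N → I j s' → Frame p s s' →
      Runs (.loop t p) s' (r * (t.cost + c) + t.cost)
        (fun s' => ∃ j ≤ N, I j s' ∧ ¬ t.holds s') from
    H N 0 s (zero_add N) h0 Frame.rfl
  intro r
  induction r with
  | zero =>
    intro j s' hj hI hf
    have hn : ¬ t.holds s' := fun ht => by have := (hstep j s' hI hf ht).1; omega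
    exact ⟨_, _, Exec.loop_false hn, by simp, j, by omega, hI, hn⟩
  | succ r ih =>
    intro j s' hj hI hf
    by_cases ht : t.holds s'
    · obtain ⟨-, k, s₁, he, hk, hI'⟩ := hstep j s' hI hf ht
      obtain ⟨l, s₂, he', hl, hQ⟩ := ih (j + 1) s₁ (by omega) hI' (hf.trans he.frame)
      refine ⟨_, _, Exec.loop_true ht he he', ?_, hQ⟩
      rw [Nat.succ_mul]
      omega
    · exact ⟨_, _, Exec.loop_false ht, Nat.le_add_left _ _, j, by omega, hI, ht⟩

/-- Loop-free programs. -/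
def Prog.LoopFree : Prog → Prop
  | skip => True
  | setIdx _ _ => True
  | setReg _ _ => True
  | setArr _ _ _ => True
  | seq p q => p.LoopFree ∧ q.LoopFree
  | ite _ p q => p.LoopFree ∧ q.LoopFree
  | loop _ _ => False

open Classical in
/-- The final state of a loop-free program (the value at a loop is immaterial). -/
noncomputable def Prog.run (s : State) : Prog → State
  | skip => s
  | setIdx x e => { s with idx := Function.update s.idx x (e.eval s) }
  | setReg x e => { s with reg := Function.update s.reg x (e.eval s) }
  | setArr a i e =>
    { s with arr := Function.update s.arr a (Function.update (s.arr a) (i.eval s) (e.eval s)) }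
  | seq p q => q.run (p.run s)
  | ite b p q => if b.holds s then p.run s else q.run s
  | loop _ _ => s

/-- An upper bound for the number of steps of a loop-free program. -/
def Prog.cost : Prog → ℕ
  | skip => 1
  | setIdx _ e => e.cost + 1
  | setReg _ e => e.cost + 1
  | setArr _ i e => i.cost + e.cost + 1
  | seq p q => p.cost + q.cost
  | ite b p q => b.cost + (p.cost + q.cost)
  | loop _ _ => 0

theorem Runs.of_loopFree (hp : p.LoopFree) (hc : p.cost ≤ b) (hQ : Q (p.run s)) :
    Runs p s b Q := by
  suffices H : ∀ s, ∃ k ≤ p.cost, Exec p s k (p.run s) by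
    obtain ⟨k, hk, he⟩ := H s
    exact ⟨k, _, he, hk.trans hc, hQ⟩
  clear hc hQ
  induction p with
  | skip => exact fun s => ⟨_, le_rfl, .skip s⟩
  | setIdx x e => exact fun s => ⟨_, le_rfl, .setIdx x e s⟩
  | setReg x e => exact fun s => ⟨_, le_rfl, .setReg x e s⟩
  | setArr a i e => exact fun s => ⟨_, le_rfl, .setArr a i e s⟩
  | seq p q ihp ihq =>
    intro s
    obtain ⟨k, hk, he⟩ := ihp hp.1 s
    obtain ⟨l, hl, he'⟩ := ihq hp.2 (p.run s)
    exact ⟨_, add_le_add hk hl, he.seq he'⟩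
  | ite t p q ihp ihq =>
    intro s
    by_cases ht : t.holds s
    · obtain ⟨k, hk, he⟩ := ihp hp.1 s
      simp only [Prog.run, if_pos ht]
      exact ⟨_, by simp only [Prog.cost]; omega, .ite_true ht he⟩
    · obtain ⟨k, hk, he⟩ := ihq hp.2 s
      simp only [Prog.run, if_neg ht]
      exact ⟨_, by simp only [Prog.cost]; omega, .ite_false ht he⟩
  | loop => exact hp.elim

/-- `for x := lo, …, hi - 1 do p`. -/
def Prog.forLoop (x : ℕ) (lo hi : NExpr) (p : Prog) : Prog :=
  .seq (.setIdx x lo)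
    (.loop (.ltN (.var x) hi) (.seq p (.setIdx x (.add (.var x) (.const 1)))))

@[simp] theorem Prog.writesIdx_forLoop {y x : ℕ} {lo hi : NExpr} :
    (Prog.forLoop x lo hi p).WritesIdx y ↔ y = x ∨ p.WritesIdx y := by
  simp only [Prog.forLoop, Prog.WritesIdx]; tauto

@[simp] theorem Prog.writesReg_forLoop {y x : ℕ} {lo hi : NExpr} :
    (Prog.forLoop x lo hi p).WritesReg y ↔ p.WritesReg y := by
  simp only [Prog.forLoop, Prog.WritesReg]; tauto

@[simp] theorem Prog.writesArr_forLoop {y x : ℕ} {lo hi : NExpr} :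
    (Prog.forLoop x lo hi p).WritesArr y ↔ p.WritesArr y := by
  simp only [Prog.forLoop, Prog.WritesArr]; tauto

/-- The rule for counting loops, with an invariant that does not depend on the counter register. -/
theorem Runs.forLoop {x : ℕ} {lo hi : NExpr} (I : ℕ → State → Prop) (l h : ℕ)
    (hlh : l ≤ h) (hx : ¬ p.WritesIdx x)
    (hI : ∀ j s v, I j s → I j { s with idx := Function.update s.idx x v })
    (hlo : lo.eval s = l)
    (hhi : ∀ s', Frame (.forLoop x lo hi p) s s' → hi.eval s' = h) (h0 : I l s)
    (hstep : ∀ j s', l ≤ j → j < h → s'.idx x = j → Frame (.forLoop x lo hi p) s s' → I j s' →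
      Runs p s' c (I (j + 1))) :
    Runs (.forLoop x lo hi p) s ((h - l + 1) * (c + hi.cost + 6) + lo.cost) (I h) := by
  have hset : Runs (.setIdx x lo) s (lo.cost + 1) (fun s' => s'.idx x = l ∧ I l s') := by
    refine Runs.of_loopFree trivial le_rfl ⟨?_, hI _ _ _ h0⟩
    simp [Prog.run, hlo]
  have hW : ∀ {s'}, Frame (.setIdx x lo) s s' → Frame (.forLoop x lo hi p) s s' := fun hf =>
    hf.mono (fun _ => Or.inl) (fun _ => Or.inl) fun _ => Or.inl
  refine Runs.mono (Runs.seq hset fun s₁ hs₁ hf₁ => Runs.loop (c := c + 4)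
    (fun j s' => s'.idx x = l + j ∧ l + j ≤ h ∧ I (l + j) s') (h - l)
    ⟨hs₁.1, hlh, hs₁.2⟩ fun j s₂ hj hf₂ ht => ?_) ?_ ?_
  · have hf : Frame (.forLoop x lo hi p) s s₂ :=
      (hW hf₁).trans (hf₂.mono (fun _ => Or.inr) (fun _ => Or.inr) fun _ => Or.inr)
    have hlt : l + j < h := by
      simpa [Test.holds, NExpr.eval, hhi s₂ hf, hj.1] using ht
    refine ⟨by omega,
      Runs.seq (hstep (l + j) s₂ (by omega) hlt hj.1 hf hj.2.2) fun s₃ hs₃ hf₃ => ?_⟩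
    refine Runs.of_loopFree trivial le_rfl ⟨?_, by omega, hI _ _ _ (by rwa [add_assoc] at hs₃)⟩
    simp [Prog.run, NExpr.eval, hf₃.idx x hx, hj.1]
    omega
  · simp only [Test.cost, NExpr.cost]
    rw [Nat.add_mul, show 1 + hi.cost + 1 + (c + 4) = c + hi.cost + 6 by ring]
    omega
  · rintro s' ⟨j, hj, ⟨h1, h2, h3⟩, hn⟩ hf
    have : hi.eval s' = h := hhi s' hf
    simp only [Test.holds, NExpr.eval, this, h1, not_lt] at hn
    rwa [show h = l + j by omega]

end RAM

/-! ### The parts of the algorithm -/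

namespace RAM

/-- Index register `1` receives the least common multiple of `1, …, n`. The least common multiple
of two numbers is found by adding to the smaller one of two multiples until they agree. -/
def lcmProg : Prog :=
  .seq (.setIdx 1 (.const 1))
    (.forLoop 2 (.const 0) (.var 0)
      (.seq (.seq (.setIdx 3 (.var 1)) (.setIdx 4 (.add (.var 2) (.const 1))))
        (.seq
          (.loop (.ltN (.const 0) (.add (.sub (.var 3) (.var 4)) (.sub (.var 4) (.var 3))))
            (.ite (.ltN (.var 3) (.var 4)) (.setIdx 3 (.add (.var 3) (.var 1)))
              (.setIdx 4 (.add (.var 4) (.add (.var 2) (.const 1))))))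
          (.setIdx 1 (.var 3)))))

/-- A proper multiple of `a` below a common multiple of `a` and `b` stays below it when `a` is
added. -/
theorem add_le_of_dvd_of_lt {a x L : ℕ} (hx : a ∣ x) (hL : a ∣ L) (h : x < L) : x + a ≤ L := by
  obtain ⟨y, rfl⟩ := hx
  obtain ⟨z, rfl⟩ := hL
  have hyz : y < z := lt_of_mul_lt_mul_left' h
  calc a * y + a = a * (y + 1) := by ring
    _ ≤ a * z := Nat.mul_le_mul_left a hyz

theorem lcmUpto_succ (n : ℕ) : (n + 1).lcmUpto = Nat.lcm n.lcmUpto (n + 1) := by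
  rw [Nat.lcmUpto, Nat.lcmUpto, ← Finset.insert_Icc_right_eq_Icc_add_one (by omega),
    Finset.lcm_insert, lcm_comm]
  rfl

theorem lcmUpto_le_lcmUpto {m n : ℕ} (h : m ≤ n) : m.lcmUpto ≤ n.lcmUpto :=
  Nat.le_of_dvd n.lcmUpto_pos (Finset.lcm_mono (Finset.Icc_subset_Icc_right h))

theorem runs_lcmProg (s : State) : Runs lcmProg s ((s.idx 0 + 1) * (200 * (s.idx 0).lcmUpto + 200))
    (fun s' => s'.idx 1 = (s.idx 0).lcmUpto) := by
  set n := s.idx 0 with hn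
  refine Runs.mono (Runs.seq (a := 2) (R := fun s' => s'.idx 1 = 1) ?_ fun s₁ hs₁ hf₁ =>
    Runs.forLoop (c := 48 * n.lcmUpto + 40) (fun j s' => s'.idx 1 = j.lcmUpto) 0 n (Nat.zero_le _)
      (by simp [Prog.WritesIdx]) (fun j s' v h => ?_) rfl (fun s' hf => ?_) ?_
      fun j s₂ _ hjn hj hf₂ hI => ?_) ?_ fun s' h _ => h
  · exact Runs.of_loopFree trivial (by simp [Prog.cost, NExpr.cost])
      (by simp [Prog.run, NExpr.eval])
  · simpa using h
  · have h1 := hf.idx 0 (by simp [Prog.WritesIdx])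
    have h2 := hf₁.idx 0 (by simp [Prog.WritesIdx])
    simp only [NExpr.eval, h1, h2, hn]
  · simp [hs₁, Nat.lcmUpto]
  · set L := (j + 1).lcmUpto with hL
    set a := j.lcmUpto with ha
    have ha0 : 0 < a := Nat.lcmUpto_pos j
    have hLlcm : L = Nat.lcm a (j + 1) := lcmUpto_succ j
    have haL : a ∣ L := hLlcm ▸ Nat.dvd_lcm_left _ _
    have hjL : j + 1 ∣ L := hLlcm ▸ Nat.dvd_lcm_right _ _
    have hL0 : 0 < L := Nat.lcmUpto_pos _
    have hLn : L ≤ n.lcmUpto := lcmUpto_le_lcmUpto hjn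
    refine Runs.mono (Runs.seq (a := 6) (R := fun s' => s'.idx 1 = a ∧ s'.idx 2 = j ∧
      s'.idx 3 = a ∧ s'.idx 4 = j + 1) ?_ fun s₃ hs₃ hf₃ => Runs.seq (b := 2) (Runs.loop (c := 14)
        (fun r s' => r + 2 ≤ s'.idx 3 + s'.idx 4 ∧ a ∣ s'.idx 3 ∧ j + 1 ∣ s'.idx 4 ∧
          0 < s'.idx 3 ∧ s'.idx 3 ≤ L ∧ s'.idx 4 ≤ L) (2 * L) ?_ fun r s₄ hr hf₄ ht => ?_)
        fun s₅ hs₅ hf₅ => ?_) ?_ fun s' h _ => h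
    · exact Runs.of_loopFree ⟨trivial, trivial⟩ (by simp [Prog.cost, NExpr.cost])
        (by simp [Prog.run, NExpr.eval, hI, hj])
    · obtain ⟨h1, h2, h3, h4⟩ := hs₃
      rw [h3, h4]
      exact ⟨by omega, dvd_rfl, dvd_rfl, ha0, Nat.le_of_dvd hL0 haL, Nat.le_of_dvd hL0 hjL⟩
    · obtain ⟨h1, h2, h3, h4, h5, h6⟩ := hr
      have e1 : s₄.idx 1 = a := (hf₄.idx 1 (by simp [Prog.WritesIdx])).trans hs₃.1
      have e2 : s₄.idx 2 = j := (hf₄.idx 2 (by simp [Prog.WritesIdx])).trans hs₃.2.1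
      have hne : s₄.idx 3 ≠ s₄.idx 4 := by
        intro h
        simp [Test.holds, NExpr.eval, h] at ht
      refine ⟨by omega, Runs.of_loopFree ⟨trivial, trivial⟩ (by simp [Prog.cost, NExpr.cost,
        Test.cost]) ?_⟩
      by_cases hlt : s₄.idx 3 < s₄.idx 4
      · have := add_le_of_dvd_of_lt h2 haL (hlt.trans_le h6)
        simp only [Prog.run, Test.holds, NExpr.eval, hlt, if_true, e1]
        simp only [Function.update_self, Function.update_of_ne (show 4 ≠ 3 by decide)]
        exact ⟨by omega, (Nat.dvd_add_right h2).2 dvd_rfl, h3, by omega, this, h6⟩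
      · have := add_le_of_dvd_of_lt h3 hjL (lt_of_lt_of_le (by omega) h5)
        simp only [Prog.run, Test.holds, NExpr.eval, hlt, if_false, e2]
        simp only [Function.update_self, Function.update_of_ne (show 3 ≠ 4 by decide)]
        exact ⟨by omega, h2, (Nat.dvd_add_right h3).2 dvd_rfl, h4, h5, this⟩
    · obtain ⟨r, -, ⟨h1, h2, h3, h4, h5, h6⟩, hn⟩ := hs₅
      refine Runs.of_loopFree trivial le_rfl ?_
      have heq : s₅.idx 3 = s₅.idx 4 := by
        simp only [Test.holds, NExpr.eval] at hn
        omega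
      simp only [Prog.run, NExpr.eval, Function.update_self]
      refine le_antisymm h5 (Nat.le_of_dvd h4 ?_)
      rw [hLlcm]
      exact Nat.lcm_dvd h2 (heq ▸ h3)
    · simp only [Test.cost, NExpr.cost]
      omega
  · simp only [NExpr.cost]
    rw [Nat.sub_zero]
    nlinarith [Nat.zero_le (n * n.lcmUpto)]

/-- Index register `5` receives `⌊T⌋`, where `T` is in rational register `0`. -/
def floorProg : Prog :=
  .seq (.setIdx 5 (.const 0))
    (.seq (.loop (.ltQ (.ofIdx (.var 5)) (.var 0)) (.setIdx 5 (.add (.var 5) (.const 1))))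
      (.ite (.ltQ (.var 0) (.ofIdx (.var 5))) (.setIdx 5 (.sub (.var 5) (.const 1))) .skip))

theorem runs_floorProg (s : State) (hT : 0 ≤ s.reg 0) :
    Runs floorProg s (20 * ⌊s.reg 0⌋₊ + 40)
      (fun s' => (s'.idx 5 : ℚ) ≤ s.reg 0 ∧ s.reg 0 < s'.idx 5 + 1) := by
  set T := s.reg 0 with hTdef
  refine Runs.mono (Runs.seq (a := 2) (R := fun s' => s'.idx 5 = 0) ?_ fun s₁ hs₁ hf₁ =>
    Runs.seq (b := 10) (Runs.loop (c := 4)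
      (fun j s' => s'.idx 5 = j ∧ (j = 0 ∨ (j : ℚ) < T + 1)) (⌊T⌋₊ + 1) ⟨hs₁, Or.inl rfl⟩
      fun j s₂ hj hf₂ ht => ?_) fun s₃ hs₃ hf₃ => ?_) ?_ fun s' h _ => h
  · exact Runs.of_loopFree trivial (by simp [Prog.cost, NExpr.cost])
      (by simp [Prog.run, NExpr.eval])
  · have e : s₂.reg 0 = T := (hf₂.reg 0 (by simp [Prog.WritesReg])).trans
      (hf₁.reg 0 (by simp [Prog.WritesReg]))
    simp only [Test.holds, QExpr.eval, NExpr.eval, hj.1, e] at ht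
    refine ⟨?_, Runs.of_loopFree trivial (by simp [Prog.cost, NExpr.cost])
      (by simp [Prog.run, NExpr.eval, hj.1, ht])⟩
    exact_mod_cast ht.trans (Nat.lt_floor_add_one T)
  · obtain ⟨j, -, ⟨h1, h2⟩, hn⟩ := hs₃
    have e : s₃.reg 0 = T := (hf₃.reg 0 (by simp [Prog.WritesReg])).trans
      (hf₁.reg 0 (by simp [Prog.WritesReg]))
    simp only [Test.holds, QExpr.eval, NExpr.eval, h1, e, not_lt] at hn
    refine Runs.of_loopFree ⟨trivial, trivial⟩ (by simp [Prog.cost, NExpr.cost, QExpr.cost,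
      Test.cost]) ?_
    by_cases hlt : T < j
    · have hj0 : j ≠ 0 := by
        rintro rfl
        simp only [Nat.cast_zero] at hlt
        linarith
      obtain ⟨i, rfl⟩ := Nat.exists_eq_succ_of_ne_zero hj0
      have h3 := h2.resolve_left hj0
      push_cast at h3 hlt
      simp only [Prog.run, Test.holds, QExpr.eval, NExpr.eval, h1, e, Nat.cast_succ, hlt, if_true,
        Function.update_self, Nat.succ_sub_one]
      exact ⟨by linarith, trivial⟩
    · simp only [Prog.run, Test.holds, QExpr.eval, NExpr.eval, h1, e, hlt, if_false]
      exact ⟨not_lt.1 hlt, by linarith⟩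
  · simp only [Test.cost, NExpr.cost, QExpr.cost]
    omega

/-- Rational register `2` receives the least positive entry of the matrix in array `2`. -/
def minProg : Prog :=
  .seq (.setReg 2 (.const 1))
    (.forLoop 6 (.const 0) (.mul (.var 0) (.var 0))
      (.ite (.ltQ (.const 0) (.get 2 (.var 6)))
        (.ite (.ltQ (.get 2 (.var 6)) (.var 2)) (.setReg 2 (.get 2 (.var 6))) .skip) .skip))

theorem runs_minProg {n : ℕ} (C : MarkovChain n) (s : State) (hn : s.idx 0 = n)
    (hM : ∀ i j : Fin n, s.arr 2 (i * n + j) = C.M i j) :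
    Runs minProg s (40 * (n * n + 1)) (fun s' => s'.reg 2 = C.minProb) := by
  refine Runs.mono (Runs.seq (a := 2) (R := fun s' => s'.reg 2 = 1) ?_ fun s₁ hs₁ hf₁ =>
    Runs.forLoop (c := 15) (fun k s' => (∀ l < k, 0 < s.arr 2 l → s'.reg 2 ≤ s.arr 2 l) ∧
      C.minProb ≤ s'.reg 2) 0 (n * n) (Nat.zero_le _)
      (by simp [Prog.WritesIdx]) (fun j s' v h => h) rfl (fun s' hf => ?_) ?_
      fun k s₂ _ hkn hk hf₂ hI => ?_) ?_ fun s' h _ => ?_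
  · exact Runs.of_loopFree trivial (by simp [Prog.cost, QExpr.cost])
      (by simp [Prog.run, QExpr.eval])
  · have h1 := hf.idx 0 (by simp [Prog.WritesIdx])
    have h2 := hf₁.idx 0 (by simp [Prog.WritesIdx])
    simp only [NExpr.eval, h1, h2, hn]
  · exact ⟨fun l hl => absurd hl (Nat.not_lt_zero l), hs₁ ▸ C.minProb_le_one⟩
  · have e : s₂.arr 2 = s.arr 2 := (hf₂.arr 2 (by simp [Prog.WritesArr])).trans
      (hf₁.arr 2 (by simp [Prog.WritesArr]))
    have hmin : 0 < s.arr 2 k → C.minProb ≤ s.arr 2 k := by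
      have hn0 := C.pos
      have hdiv : k / n < n := Nat.div_lt_of_lt_mul hkn
      have := hM ⟨k / n, hdiv⟩ ⟨k % n, Nat.mod_lt k hn0⟩
      rw [Nat.div_add_mod'] at this
      rw [this]
      exact C.minProb_le
    refine Runs.of_loopFree ⟨⟨trivial, trivial⟩, trivial⟩ (by simp [Prog.cost, NExpr.cost,
      QExpr.cost, Test.cost]) ?_
    simp only [Prog.run, Test.holds, QExpr.eval, NExpr.eval, hk, e]
    obtain ⟨hI1, hI2⟩ := hI
    split_ifs with h1 h2
    · simp only [Function.update_self]
      refine ⟨fun l hl hl' => ?_, hmin h1⟩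
      rcases Nat.lt_succ_iff_lt_or_eq.1 hl with hl | rfl
      · exact h2.le.trans (hI1 l hl hl')
      · exact le_rfl
    · refine ⟨fun l hl hl' => ?_, hI2⟩
      rcases Nat.lt_succ_iff_lt_or_eq.1 hl with hl | rfl
      · exact hI1 l hl hl'
      · exact not_lt.1 h2
    · refine ⟨fun l hl hl' => ?_, hI2⟩
      rcases Nat.lt_succ_iff_lt_or_eq.1 hl with hl | rfl
      · exact hI1 l hl hl'
      · exact absurd hl' h1
  · simp only [NExpr.cost]
    omega
  · obtain ⟨i, j, hpos, hij⟩ := C.exists_eq_minProb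
    refine le_antisymm ?_ h.2
    rw [← hij, ← hM] at *
    refine h.1 _ ?_ hpos
    calc (i : ℕ) * n + j < i * n + n := by omega
      _ = (i + 1) * n := by ring
      _ ≤ n * n := Nat.mul_le_mul_right n i.2

/-- Rational register `3` receives the `n²`-th power of rational register `2`. -/
def powProg : Prog :=
  .seq (.setReg 3 (.const 1))
    (.forLoop 7 (.const 0) (.mul (.var 0) (.var 0)) (.setReg 3 (.mul (.var 3) (.var 2))))

theorem runs_powProg (s : State) {n : ℕ} (hn : s.idx 0 = n) :
    Runs powProg s (40 * (n * n + 1)) (fun s' => s'.reg 3 = s.reg 2 ^ n ^ 2) := by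
  refine Runs.mono (Runs.seq (a := 2) (R := fun s' => s'.reg 3 = 1) ?_ fun s₁ hs₁ hf₁ =>
    Runs.forLoop (c := 4) (fun k s' => s'.reg 3 = s.reg 2 ^ k) 0 (n * n) (Nat.zero_le _)
      (by simp [Prog.WritesIdx]) (fun j s' v h => h) rfl (fun s' hf => ?_) ?_
      fun k s₂ _ hkn hk hf₂ hI => ?_) ?_ fun s' h _ => ?_
  · exact Runs.of_loopFree trivial (by simp [Prog.cost, QExpr.cost])
      (by simp [Prog.run, QExpr.eval])
  · have h1 := hf.idx 0 (by simp [Prog.WritesIdx])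
    have h2 := hf₁.idx 0 (by simp [Prog.WritesIdx])
    simp only [NExpr.eval, h1, h2, hn]
  · simp [hs₁]
  · have e : s₂.reg 2 = s.reg 2 := (hf₂.reg 2 (by simp [Prog.WritesReg])).trans
      (hf₁.reg 2 (by simp [Prog.WritesReg]))
    exact Runs.of_loopFree trivial (by simp [Prog.cost, QExpr.cost])
      (by simp [Prog.run, QExpr.eval, hI, e, pow_succ])
  · simp only [NExpr.cost]
    omega
  · rw [h, sq]

/-- Rational register `4` receives the sum of the absolute values of the entries of array `1`. -/
def absSumProg : Prog :=
  .seq (.setReg 4 (.const 0))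
    (.forLoop 8 (.const 0) (.var 0)
      (.ite (.ltQ (.get 1 (.var 8)) (.const 0))
        (.setReg 4 (.sub (.var 4) (.get 1 (.var 8))))
        (.setReg 4 (.add (.var 4) (.get 1 (.var 8))))))

theorem runs_absSumProg (s : State) {n : ℕ} (hn : s.idx 0 = n) :
    Runs absSumProg s (40 * (n + 1))
      (fun s' => s'.reg 4 = ∑ i ∈ Finset.range n, |s.arr 1 i|) := by
  refine Runs.mono (Runs.seq (a := 2) (R := fun s' => s'.reg 4 = 0) ?_ fun s₁ hs₁ hf₁ =>
    Runs.forLoop (c := 20) (fun k s' => s'.reg 4 = ∑ i ∈ Finset.range k, |s.arr 1 i|) 0 n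
      (Nat.zero_le _) (by simp [Prog.WritesIdx]) (fun j s' v h => h) rfl (fun s' hf => ?_) ?_
      fun k s₂ _ hkn hk hf₂ hI => ?_) ?_ fun s' h _ => h
  · exact Runs.of_loopFree trivial (by simp [Prog.cost, QExpr.cost])
      (by simp [Prog.run, QExpr.eval])
  · have h1 := hf.idx 0 (by simp [Prog.WritesIdx])
    have h2 := hf₁.idx 0 (by simp [Prog.WritesIdx])
    simp only [NExpr.eval, h1, h2, hn]
  · simp [hs₁]
  · have e : s₂.arr 1 = s.arr 1 := (hf₂.arr 1 (by simp [Prog.WritesArr])).trans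
      (hf₁.arr 1 (by simp [Prog.WritesArr]))
    refine Runs.of_loopFree ⟨trivial, trivial⟩ (by simp [Prog.cost, NExpr.cost, QExpr.cost,
      Test.cost]) ?_
    simp only [Prog.run, Test.holds, QExpr.eval, NExpr.eval, hk, e, Finset.sum_range_succ]
    split_ifs with h
    · simp [hI, abs_of_neg h, sub_eq_add_neg]
    · simp [hI, abs_of_nonneg (not_lt.1 h)]
  · simp only [NExpr.cost]
    omega

/-- With `β` in register `3`, a bound `W` for the weights in register `4` and `m = 2 n²`, index
register `9` receives the least `k` with `4 W m² (1 - β) ^ k ≤ β² ε`. -/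
def roundsProg : Prog :=
  .seq (.seq (.setIdx 9 (.const 0))
      (.setReg 5 (.mul (.mul (.const 4) (.var 4))
        (.mul (.ofIdx (.mul (.const 2) (.mul (.var 0) (.var 0))))
          (.ofIdx (.mul (.const 2) (.mul (.var 0) (.var 0))))))))
    (.loop (.ltQ (.mul (.mul (.var 3) (.var 3)) (.var 1)) (.var 5))
      (.seq (.setReg 5 (.mul (.var 5) (.sub (.const 1) (.var 3))))
        (.setIdx 9 (.add (.var 9) (.const 1)))))

theorem runs_roundsProg (s : State) {n : ℕ} (hn : s.idx 0 = n) {β W ε : ℚ} (hβ : s.reg 3 = β)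
    (hW : s.reg 4 = W) (hε : s.reg 1 = ε) {K : ℕ}
    (hK : ∀ j, β ^ 2 * ε < 4 * W * ((2 * n ^ 2 : ℕ) : ℚ) ^ 2 * (1 - β) ^ j → j < K) :
    Runs roundsProg s (40 * (K + 1)) (fun s' => s'.idx 9 ≤ K ∧
      4 * W * ((2 * n ^ 2 : ℕ) : ℚ) ^ 2 * (1 - β) ^ s'.idx 9 ≤ β ^ 2 * ε) := by
  set z : ℚ := 4 * W * ((2 * n ^ 2 : ℕ) : ℚ) ^ 2 with hz
  refine Runs.mono (Runs.seq (a := 20) (R := fun s' => s'.idx 9 = 0 ∧ s'.reg 5 = z) ?_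
    fun s₁ hs₁ hf₁ => Runs.loop (c := 10) (fun j s' => s'.idx 9 = j ∧ s'.reg 5 = z * (1 - β) ^ j) K
      (by simp [hs₁]) fun j s₂ hj hf₂ ht => ?_) ?_ fun s' h hf => ?_
  · refine Runs.of_loopFree ⟨trivial, trivial⟩ (by simp [Prog.cost, NExpr.cost, QExpr.cost]) ?_
    refine ⟨by simp [Prog.run, NExpr.eval], ?_⟩
    simp only [Prog.run, QExpr.eval, NExpr.eval, Function.update_self,
      Function.update_of_ne (show 0 ≠ 9 by decide), hW, hn, hz]
    push_cast
    ring
  · have e3 : s₂.reg 3 = β := (hf₂.reg 3 (by simp [Prog.WritesReg])).trans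
      ((hf₁.reg 3 (by simp [Prog.WritesReg])).trans hβ)
    have e1 : s₂.reg 1 = ε := (hf₂.reg 1 (by simp [Prog.WritesReg])).trans
      ((hf₁.reg 1 (by simp [Prog.WritesReg])).trans hε)
    simp only [Test.holds, QExpr.eval, hj.2, e3, e1, ← sq] at ht
    refine ⟨hK j ht, Runs.of_loopFree ⟨trivial, trivial⟩ (by simp [Prog.cost, NExpr.cost,
      QExpr.cost]) ?_⟩
    simp [Prog.run, QExpr.eval, NExpr.eval, hj, e3, pow_succ, mul_assoc]
  · simp only [Test.cost, QExpr.cost]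
    omega
  · obtain ⟨j, hjK, hj, hn⟩ := h
    have e3 : s'.reg 3 = β := (hf.reg 3 (by simp [roundsProg, Prog.WritesReg])).trans hβ
    have e1 : s'.reg 1 = ε := (hf.reg 1 (by simp [roundsProg, Prog.WritesReg])).trans hε
    simp only [Test.holds, QExpr.eval, hj.2, e3, e1, ← sq, not_lt] at hn
    rw [hj.1]
    exact ⟨hjK, hn⟩

/-- Array `0` holds the distributions `μ Mᵗ` one after the other. With `t` in index register `11`,
the contribution of state `i` (in index register `12`) is added to the distribution at `t + 1`. -/
def rowProg : Prog :=
  .forLoop 13 (.const 0) (.var 0)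
    (.setArr 0 (.add (.mul (.add (.var 11) (.const 1)) (.var 0)) (.var 13))
      (.add (.get 0 (.add (.mul (.add (.var 11) (.const 1)) (.var 0)) (.var 13)))
        (.mul (.get 0 (.add (.mul (.var 11) (.var 0)) (.var 12)))
          (.get 2 (.add (.mul (.var 12) (.var 0)) (.var 13))))))

theorem runs_rowProg (s : State) {n t i : ℕ} (hn : s.idx 0 = n) (ht : s.idx 11 = t)
    (hi : s.idx 12 = i) (hin : i < n) :
    Runs rowProg s (40 * (n + 1)) (fun s' => ∀ k, s'.arr 0 k =
      if (t + 1) * n ≤ k ∧ k < (t + 1) * n + n then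
        s.arr 0 k + s.arr 0 (t * n + i) * s.arr 2 (i * n + (k - (t + 1) * n))
      else s.arr 0 k) := by
  refine Runs.mono (Runs.forLoop (c := 30) (fun j s' => ∀ k, s'.arr 0 k =
      if (t + 1) * n ≤ k ∧ k < (t + 1) * n + j then
        s.arr 0 k + s.arr 0 (t * n + i) * s.arr 2 (i * n + (k - (t + 1) * n))
      else s.arr 0 k) 0 n (Nat.zero_le _) (by simp [Prog.WritesIdx]) (fun j s' v h => h) rfl
      (fun s' hf => ?_) (fun k => ?_) fun j s₂ _ hjn hj hf₂ hI => ?_) ?_ fun s' h _ => h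
  · exact (hf.idx 0 (by simp [Prog.WritesIdx])).trans hn
  · rw [if_neg (by omega)]
  · have e0 : s₂.idx 0 = n := (hf₂.idx 0 (by simp [Prog.WritesIdx])).trans hn
    have e11 : s₂.idx 11 = t := (hf₂.idx 11 (by simp [Prog.WritesIdx])).trans ht
    have e12 : s₂.idx 12 = i := (hf₂.idx 12 (by simp [Prog.WritesIdx])).trans hi
    have e2 : s₂.arr 2 = s.arr 2 := hf₂.arr 2 (by simp [Prog.WritesArr])
    have h1 : s₂.arr 0 ((t + 1) * n + j) = s.arr 0 ((t + 1) * n + j) := by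
      rw [hI, if_neg (by omega)]
    have h2 : s₂.arr 0 (t * n + i) = s.arr 0 (t * n + i) := by
      rw [hI, if_neg]
      rw [Nat.add_mul]
      omega
    refine Runs.of_loopFree trivial (by simp [Prog.cost, NExpr.cost, QExpr.cost]) fun k => ?_
    simp only [Prog.run, QExpr.eval, NExpr.eval, e0, e11, e12, e2, hj, Function.update_self]
    by_cases hk : k = (t + 1) * n + j
    · rw [hk, Function.update_self, if_pos (by omega), h1, h2, Nat.add_sub_cancel_left]
    · rw [Function.update_of_ne hk, hI]
      by_cases hk' : (t + 1) * n ≤ k ∧ k < (t + 1) * n + j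
      · rw [if_pos hk', if_pos (by omega)]
      · rw [if_neg hk', if_neg (by omega)]
  · simp only [NExpr.cost]
    omega

/-- With `t` in index register `11`, the distribution at time `t + 1` is computed, and the income
at time `t` is added to rational register `6`. -/
def stepProg : Prog :=
  .forLoop 12 (.const 0) (.var 0)
    (.seq (.setReg 6 (.add (.var 6) (.mul (.get 0 (.add (.mul (.var 11) (.var 0)) (.var 12)))
      (.get 1 (.var 12))))) rowProg)

theorem runs_stepProg (s : State) {n t : ℕ} (hn : s.idx 0 = n) (ht : s.idx 11 = t)
    (h0 : ∀ k, (t + 1) * n ≤ k → s.arr 0 k = 0) :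
    Runs stepProg s (100 * (n + 1) ^ 2) (fun s' =>
      s'.reg 6 = s.reg 6 + ∑ i ∈ Finset.range n, s.arr 0 (t * n + i) * s.arr 1 i ∧
      ∀ k, s'.arr 0 k = if (t + 1) * n ≤ k ∧ k < (t + 1) * n + n then
          ∑ i ∈ Finset.range n, s.arr 0 (t * n + i) * s.arr 2 (i * n + (k - (t + 1) * n))
        else s.arr 0 k) := by
  refine Runs.mono (Runs.forLoop (c := 12 + 40 * (n + 1)) (fun i s' =>
      s'.reg 6 = s.reg 6 + ∑ i ∈ Finset.range i, s.arr 0 (t * n + i) * s.arr 1 i ∧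
      ∀ k, s'.arr 0 k = if (t + 1) * n ≤ k ∧ k < (t + 1) * n + n then
          ∑ i ∈ Finset.range i, s.arr 0 (t * n + i) * s.arr 2 (i * n + (k - (t + 1) * n))
        else s.arr 0 k) 0 n (Nat.zero_le _) (by simp [Prog.WritesIdx, rowProg])
      (fun j s' v h => h) rfl
      (fun s' hf => ?_) ⟨by simp, fun k => ?_⟩ fun i s₂ _ hin hi hf₂ hI => ?_) ?_ fun s' h _ => h
  · exact (hf.idx 0 (by simp [Prog.WritesIdx, rowProg])).trans hn
  · split_ifs with h
    · simp [h0 k h.1]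
    · rfl
  · have e0 : s₂.idx 0 = n := (hf₂.idx 0 (by simp [Prog.WritesIdx, rowProg])).trans hn
    have e11 : s₂.idx 11 = t := (hf₂.idx 11 (by simp [Prog.WritesIdx, rowProg])).trans ht
    have e1 : s₂.arr 1 = s.arr 1 := hf₂.arr 1 (by simp [Prog.WritesArr, rowProg])
    have e2 : s₂.arr 2 = s.arr 2 := hf₂.arr 2 (by simp [Prog.WritesArr, rowProg])
    have h2 : s₂.arr 0 (t * n + i) = s.arr 0 (t * n + i) := by
      rw [hI.2, if_neg]
      rw [Nat.add_mul]
      omega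
    refine Runs.seq (R := fun s' => s'.reg 6 = s.reg 6
      + ∑ i ∈ Finset.range (i + 1), s.arr 0 (t * n + i) * s.arr 1 i) ?_ fun s₃ hs₃ hf₃ => ?_
    · refine Runs.of_loopFree trivial (by simp [Prog.cost, NExpr.cost, QExpr.cost]) ?_
      simp only [Prog.run, QExpr.eval, NExpr.eval, Function.update_self, e0, e11, e1, hi, h2, hI.1,
        Finset.sum_range_succ, add_assoc]
    · have f0 : s₃.arr 0 = s₂.arr 0 := hf₃.arr 0 (by simp [Prog.WritesArr])
      have f2 : s₃.arr 2 = s.arr 2 := (hf₃.arr 2 (by simp [Prog.WritesArr])).trans e2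
      have g0 : s₃.idx 0 = n := (hf₃.idx 0 (by simp [Prog.WritesIdx])).trans e0
      have g11 : s₃.idx 11 = t := (hf₃.idx 11 (by simp [Prog.WritesIdx])).trans e11
      have g12 : s₃.idx 12 = i := (hf₃.idx 12 (by simp [Prog.WritesIdx])).trans hi
      refine Runs.mono (runs_rowProg s₃ g0 g11 g12 hin) le_rfl fun s' h hf => ⟨?_, fun k => ?_⟩
      · exact (hf.reg 6 (by simp [Prog.WritesReg, rowProg])).trans hs₃
      · rw [h, f0, f2, h2, hI.2]
        split_ifs with hk
        · rw [Finset.sum_range_succ]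
        · rfl
  · simp only [NExpr.cost, Nat.sub_zero]
    nlinarith

/-- Array `3` receives the utilities up to the sum of index registers `1` and `10`. -/
def utilityProg : Prog :=
  .seq (.setReg 6 (.const 0))
    (.forLoop 11 (.const 0) (.add (.add (.var 10) (.var 1)) (.const 1))
      (.seq stepProg (.setArr 3 (.var 11) (.var 6))))

theorem runs_utilityProg {n : ℕ} (C : MarkovChain n) (s : State) (hn : s.idx 0 = n) {B p : ℕ}
    (hB : s.idx 10 = B) (hp : s.idx 1 = p) (hμ : ∀ i : Fin n, s.arr 0 i = C.μ i)
    (h0 : ∀ k, n ≤ k → s.arr 0 k = 0) (hw : ∀ i : Fin n, s.arr 1 i = C.w i)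
    (hM : ∀ i j : Fin n, s.arr 2 (i * n + j) = C.M i j) :
    Runs utilityProg s (200 * (n + 1) ^ 2 * (B + p + 2))
      (fun s' => ∀ t ≤ B + p, s'.arr 3 t = C.utility t) := by
  refine Runs.mono (Runs.seq (a := 2) (R := fun s' => s'.reg 6 = 0) ?_ fun s₁ hs₁ hf₁ =>
    Runs.forLoop (c := 100 * (n + 1) ^ 2 + 3) (fun t s' =>
      s'.reg 6 = ∑ τ ∈ Finset.range t, C.income τ ∧
      (∀ i : Fin n, s'.arr 0 (t * n + i) = (C.μ ᵥ* C.M ^ t) i) ∧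
      (∀ k, (t + 1) * n ≤ k → s'.arr 0 k = 0) ∧
      ∀ τ < t, s'.arr 3 τ = C.utility τ) 0 (B + p + 1) (Nat.zero_le _)
      (by simp [Prog.WritesIdx, rowProg, stepProg]) (fun j s' v h => h) rfl (fun s' hf => ?_) ?_
      fun t s₂ _ htB ht hf₂ hI => ?_) ?_ fun s' h _ t ht => h.2.2.2 t (Nat.lt_succ_of_le ht)
  · exact Runs.of_loopFree trivial (by simp [Prog.cost, QExpr.cost])
      (by simp [Prog.run, QExpr.eval])
  · have h1 := hf.idx 10 (by simp [Prog.WritesIdx, rowProg, stepProg])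
    have h2 := hf₁.idx 10 (by simp [Prog.WritesIdx])
    have h3 := hf.idx 1 (by simp [Prog.WritesIdx, rowProg, stepProg])
    have h4 := hf₁.idx 1 (by simp [Prog.WritesIdx])
    simp only [NExpr.eval, h1, h2, h3, h4, hB, hp]
  · have e0 := hf₁.arr 0 (by simp [Prog.WritesArr])
    refine ⟨by simp [hs₁], fun i => ?_, fun k hk => ?_, fun τ hτ => absurd hτ (Nat.not_lt_zero τ)⟩
    · simp [e0, hμ]
    · rw [e0, h0 k (by omega)]
  · have g0 : s₂.idx 0 = n := (hf₂.idx 0 (by simp [Prog.WritesIdx, rowProg, stepProg])).trans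
      ((hf₁.idx 0 (by simp [Prog.WritesIdx])).trans hn)
    have e1 : s₂.arr 1 = s.arr 1 :=
      (hf₂.arr 1 (by simp [Prog.WritesArr, rowProg, stepProg])).trans
        (hf₁.arr 1 (by simp [Prog.WritesArr]))
    have e2 : s₂.arr 2 = s.arr 2 :=
      (hf₂.arr 2 (by simp [Prog.WritesArr, rowProg, stepProg])).trans
        (hf₁.arr 2 (by simp [Prog.WritesArr]))
    obtain ⟨hI6, hIx, hI0, hI3⟩ := hI
    refine Runs.seq (runs_stepProg s₂ g0 ht hI0) fun s₃ hs₃ hf₃ => ?_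
    have f11 : s₃.idx 11 = t :=
      (hf₃.idx 11 (by simp [Prog.WritesIdx, rowProg, stepProg])).trans ht
    have f3 : s₃.arr 3 = s₂.arr 3 := hf₃.arr 3 (by simp [Prog.WritesArr, rowProg, stepProg])
    have hinc : ∑ i ∈ Finset.range n, s₂.arr 0 (t * n + i) * s₂.arr 1 i = C.income t := by
      rw [← Fin.sum_univ_eq_sum_range (fun i => s₂.arr 0 (t * n + i) * s₂.arr 1 i) n]
      simp only [e1, hw, hIx]
      rfl
    have h6 : s₃.reg 6 = ∑ τ ∈ Finset.range (t + 1), C.income τ := by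
      rw [hs₃.1, hI6, hinc, Finset.sum_range_succ]
    refine Runs.of_loopFree trivial (by simp [Prog.cost, NExpr.cost, QExpr.cost]) ?_
    simp only [Prog.run, NExpr.eval, QExpr.eval, f11, Function.update_self, h6,
      Function.update_of_ne (show 0 ≠ 3 by decide), true_and]
    refine ⟨fun i => ?_, fun k hk => ?_, fun τ hτ => ?_⟩
    · have hi := i.2
      rw [hs₃.2, if_pos (by omega), Nat.add_sub_cancel_left,
        ← Fin.sum_univ_eq_sum_range
          (fun j => s₂.arr 0 (t * n + j) * s₂.arr 2 (j * n + i)) n]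
      simp only [e2, hM, hIx]
      rw [pow_succ, ← Matrix.vecMul_vecMul]
      rfl
    · have hk' : (t + 1) * n + n ≤ k := by
        calc (t + 1) * n + n = (t + 1 + 1) * n := by ring
          _ ≤ k := hk
      rw [hs₃.2, if_neg (by omega), hI0 k (by omega)]
    · by_cases h : τ = t
      · subst h
        rw [Function.update_self]
        rfl
      · rw [Function.update_of_ne h, f3, hI3 τ (by omega)]
  · simp only [NExpr.cost, Nat.sub_zero]
    nlinarith [Nat.zero_le (n * n * (B + p)), Nat.zero_le (n * (B + p)), Nat.zero_le (n * n)]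

/-- Rational register `7` is replaced by the value of `e` if this is smaller. -/
def candProg (e : QExpr) : Prog :=
  .seq (.setReg 9 e) (.ite (.ltQ (.var 9) (.var 7)) (.setReg 7 (.var 9)) .skip)

theorem run_candProg (e : QExpr) (s : State) :
    ((candProg e).run s).reg 7 = min (s.reg 7) (e.eval s) := by
  simp only [candProg, Prog.run, Test.holds, QExpr.eval, Function.update_self,
    Function.update_of_ne (show 7 ≠ 9 by decide)]
  split_ifs with h
  · simp [min_eq_right h.le]
  · simp [min_eq_left (not_lt.1 h)]

/-- The ray of slope `a` (in register `8`) from the utility at time `x`, evaluated at `T`. -/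
def rayExpr (x : ℕ) : QExpr :=
  .add (.get 3 (.var x)) (.mul (.sub (.var 0) (.ofIdx (.var x))) (.var 8))

/-- The chord between the utilities at the times in registers `14` and `15`, evaluated at `T`. -/
def chordExpr : QExpr :=
  .add (.get 3 (.var 14)) (.div
    (.mul (.sub (.var 0) (.ofIdx (.var 14))) (.sub (.get 3 (.var 15)) (.get 3 (.var 14))))
    (.sub (.ofIdx (.var 15)) (.ofIdx (.var 14))))

/-- Rational register `0` receives the least value at `T` of a ray of slope `a` or a chord, where
`a` is the mean slope of the utilities over the last `p` steps. -/
def minimizeProg : Prog :=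
  .seq
    (.seq (.setReg 8 (.div (.sub (.get 3 (.add (.var 10) (.var 1))) (.get 3 (.var 10)))
        (.ofIdx (.var 1))))
      (.setReg 7 (rayExpr 5)))
    (.seq
      (.forLoop 14 (.const 0) (.add (.var 5) (.const 1))
        (.seq (candProg (rayExpr 14))
          (.forLoop 15 (.add (.var 5) (.const 1)) (.add (.add (.var 10) (.var 1)) (.const 1))
            (candProg chordExpr))))
      (.setReg 0 (.var 7)))

theorem runs_minimizeProg (s : State) {F B p : ℕ} {T : ℚ} {u : ℕ → ℚ} (hF : s.idx 5 = F)
    (hB : s.idx 10 = B) (hp : s.idx 1 = p) (hT : s.reg 0 = T) (hFB : F ≤ B)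
    (hu : ∀ t ≤ B + p, s.arr 3 t = u t) {a : ℚ} (ha : a = (u (B + p) - u B) / p) :
    Runs minimizeProg s (200 * (F + 2) * (B + p - F + 2)) (fun s' =>
      (∀ r ≤ F, s'.reg 0 ≤ u r + (T - r) * a) ∧
      (∀ r ≤ F, ∀ t, F < t → t ≤ B + p → s'.reg 0 ≤ chord u T r t) ∧
      ((∃ r ≤ F, s'.reg 0 = u r + (T - r) * a) ∨
        ∃ r ≤ F, ∃ t, F < t ∧ s'.reg 0 = chord u T r t)) := by
  -- the part of the invariant which says that register `7` holds one of the candidates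
  set cand : ℚ → Prop := fun b => (∃ r ≤ F, b = u r + (T - r) * a) ∨
    ∃ r ≤ F, ∃ t, F < t ∧ b = chord u T r t with hcand
  have hmin : ∀ {b b'}, cand b → cand b' → cand (min b b') := fun {b b'} h h' => by
    rcases min_choice b b' with h1 | h1 <;> rwa [h1]
  refine Runs.mono (Runs.seq (a := 21) (R := fun s' => s'.reg 8 = a ∧ s'.reg 7 = u F + (T - F) * a)
    ?_ fun s₁ hs₁ hf₁ => Runs.seq (b := 2) (Runs.forLoop (c := 20 + (50 * (B + p - F + 2)))
      (fun i s' => cand (s'.reg 7) ∧ (∀ r < i, s'.reg 7 ≤ u r + (T - r) * a) ∧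
        ∀ r < i, ∀ t, F < t → t ≤ B + p → s'.reg 7 ≤ chord u T r t) 0 (F + 1) (Nat.zero_le _)
      (by simp [Prog.WritesIdx, candProg]) (fun j s' v h => h) rfl (fun s' hf => ?_) ?_
      fun i s₂ _ hiF hi hf₂ hI => ?_) fun s₃ hs₃ hf₃ => ?_) ?_ fun s' h _ => h
  · refine Runs.of_loopFree ⟨trivial, trivial⟩
      (by simp [Prog.cost, NExpr.cost, QExpr.cost, rayExpr]) ?_
    have hu1 := hu _ (le_refl (B + p))
    have hu2 := hu B (by omega)
    have hu3 := hu F (by omega)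
    simp only [Prog.run, QExpr.eval, NExpr.eval, rayExpr, Function.update_self,
      Function.update_of_ne (show 8 ≠ 7 by decide), Function.update_of_ne (show 0 ≠ 8 by decide),
      hF, hB, hp, hT, hu1, hu2, hu3, ha, and_self]
  · have h1 := hf.idx 5 (by simp [Prog.WritesIdx, candProg])
    have h2 := hf₁.idx 5 (by simp [Prog.WritesIdx])
    simp only [NExpr.eval, h1, h2, hF]
  · exact ⟨Or.inl ⟨F, le_rfl, hs₁.2⟩, fun r hr => absurd hr (Nat.not_lt_zero r),
      fun r hr => absurd hr (Nat.not_lt_zero r)⟩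
  · have g5 : s₂.idx 5 = F := (hf₂.idx 5 (by simp [Prog.WritesIdx, candProg])).trans
      ((hf₁.idx 5 (by simp [Prog.WritesIdx])).trans hF)
    have g10 : s₂.idx 10 = B := (hf₂.idx 10 (by simp [Prog.WritesIdx, candProg])).trans
      ((hf₁.idx 10 (by simp [Prog.WritesIdx])).trans hB)
    have g1 : s₂.idx 1 = p := (hf₂.idx 1 (by simp [Prog.WritesIdx, candProg])).trans
      ((hf₁.idx 1 (by simp [Prog.WritesIdx])).trans hp)
    have r0 : s₂.reg 0 = T := (hf₂.reg 0 (by simp [Prog.WritesReg, candProg])).trans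
      ((hf₁.reg 0 (by simp [Prog.WritesReg])).trans hT)
    have r8 : s₂.reg 8 = a := (hf₂.reg 8 (by simp [Prog.WritesReg, candProg])).trans hs₁.1
    have e3 : s₂.arr 3 = s.arr 3 := (hf₂.arr 3 (by simp [Prog.WritesArr, candProg])).trans
      (hf₁.arr 3 (by simp [Prog.WritesArr]))
    obtain ⟨hIc, hIr, hIch⟩ := hI
    refine Runs.mono (Runs.seq (a := 20)
      (R := fun s' => s'.reg 7 = min (s₂.reg 7) (u i + (T - i) * a))
      ?_ fun s₃ hs₃ hf₃ => Runs.forLoop (c := 26)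
        (fun t s' => cand (s'.reg 7) ∧ s'.reg 7 ≤ min (s₂.reg 7) (u i + (T - i) * a) ∧
          ∀ τ, F < τ → τ < t → s'.reg 7 ≤ chord u T i τ) (F + 1) (B + p + 1) (by omega)
        ?_ (fun j s' v h => h) ?_ (fun s' hf => ?_)
        ⟨?_, hs₃.le, fun τ h h' => by omega⟩
        fun t s₄ hFt htB ht hf₄ hJ => ?_) ?_ fun s' h _ => ?_
    · refine Runs.of_loopFree ⟨trivial, trivial, trivial⟩
        (by simp [Prog.cost, NExpr.cost, QExpr.cost, Test.cost, rayExpr, candProg]) ?_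
      simp only [run_candProg, rayExpr, QExpr.eval, NExpr.eval, hi, e3, r0, r8, hu i (by omega)]
    · simp [Prog.WritesIdx, candProg]
    · have h5 := hf₃.idx 5 (by simp [Prog.WritesIdx, candProg])
      simp only [NExpr.eval, h5, g5]
    · have h10 := hf.idx 10 (by simp [Prog.WritesIdx, candProg])
      have h10' := hf₃.idx 10 (by simp [Prog.WritesIdx, candProg])
      have h1 := hf.idx 1 (by simp [Prog.WritesIdx, candProg])
      have h1' := hf₃.idx 1 (by simp [Prog.WritesIdx, candProg])
      simp only [NExpr.eval, h10, h10', h1, h1', g10, g1]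
    · rw [hs₃]
      exact hmin hIc (Or.inl ⟨i, by omega, rfl⟩)
    · have k14 : s₄.idx 14 = i := (hf₄.idx 14 (by simp [Prog.WritesIdx, candProg])).trans
        ((hf₃.idx 14 (by simp [Prog.WritesIdx, candProg])).trans hi)
      have k0 : s₄.reg 0 = T := (hf₄.reg 0 (by simp [Prog.WritesReg, candProg])).trans
        ((hf₃.reg 0 (by simp [Prog.WritesReg, candProg])).trans r0)
      have k3 : s₄.arr 3 = s.arr 3 := (hf₄.arr 3 (by simp [Prog.WritesArr, candProg])).trans
        ((hf₃.arr 3 (by simp [Prog.WritesArr, candProg])).trans e3)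
      refine Runs.of_loopFree ⟨trivial, trivial, trivial⟩
        (by simp [Prog.cost, NExpr.cost, QExpr.cost, Test.cost, chordExpr, candProg]) ?_
      have hval : chordExpr.eval s₄ = chord u T i t := by
        simp only [chordExpr, QExpr.eval, NExpr.eval, k14, ht, k0, k3, hu i (by omega),
          hu t (by omega), chord]
      rw [run_candProg, hval]
      obtain ⟨hJ1, hJ2, hJ3⟩ := hJ
      refine ⟨hmin hJ1 (Or.inr ⟨i, by omega, t, by omega, rfl⟩), (min_le_left _ _).trans hJ2,
        fun τ h1 h2 => ?_⟩
      rcases Nat.lt_succ_iff_lt_or_eq.1 h2 with h2 | rfl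
      · exact (min_le_left _ _).trans (hJ3 τ h1 h2)
      · exact min_le_right _ _
    · simp only [NExpr.cost]
      omega
    · obtain ⟨h1, h2, h3⟩ := h
      refine ⟨h1, fun r hr => ?_, fun r hr t ht ht' => ?_⟩
      · rcases Nat.lt_succ_iff_lt_or_eq.1 hr with hr | rfl
        · exact (h2.trans (min_le_left _ _)).trans (hIr r hr)
        · exact h2.trans (min_le_right _ _)
      · rcases Nat.lt_succ_iff_lt_or_eq.1 hr with hr | rfl
        · exact (h2.trans (min_le_left _ _)).trans (hIch r hr t ht ht')
        · exact h3 t ht (Nat.lt_succ_of_le ht')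
  · refine Runs.of_loopFree trivial le_rfl ?_
    simp only [Prog.run, QExpr.eval, Function.update_self]
    exact ⟨fun r hr => hs₃.2.1 r (Nat.lt_succ_of_le hr),
      fun r hr => hs₃.2.2 r (Nat.lt_succ_of_le hr), hs₃.1⟩
  · simp only [NExpr.cost, Nat.sub_zero]
    generalize B + p - F = x
    calc 21 + ((F + 1 + 1) * (20 + 50 * (x + 2) + (1 + 1 + 1) + 6) + 1 + 2)
        = (F + 2) * (50 * x + 129) + 24 := by ring
      _ ≤ (F + 2) * (50 * x + 129) + (F + 2) * 24 := by omega
      _ = (F + 2) * (50 * x + 153) := by ring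
      _ ≤ (F + 2) * (200 * (x + 2)) := Nat.mul_le_mul_left _ (by omega)
      _ = 200 * (F + 2) * (x + 2) := by ring

/-- The parameters of the algorithm: a common period `p`, the integral part of `T`, and a time `B`
after which the utilities are periodic up to a small error. -/
def setupProg : Prog :=
  .seq lcmProg (.seq floorProg (.seq minProg (.seq powProg (.seq absSumProg (.seq roundsProg
    (.setIdx 10 (.add (.var 5)
      (.mul (.mul (.const 2) (.mul (.var 0) (.var 0))) (.var 9)))))))))

/-- The algorithm: it computes the utilities up to a time after which they are almost periodic, and
returns the least chord or ray over `T`. -/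
def algorithm : Prog := .seq setupProg (.seq utilityProg minimizeProg)

theorem Frame.seq {p q : Prog} {s₁ s₂ s₃ : State} (h : Frame p s₁ s₂) (h' : Frame q s₂ s₃) :
    Frame (.seq p q) s₁ s₃ :=
  (h.mono (fun _ => Or.inl) (fun _ => Or.inl) fun _ => Or.inl).trans
    (h'.mono (fun _ => Or.inr) (fun _ => Or.inr) fun _ => Or.inr)

theorem input_arr_two {n : ℕ} (C : MarkovChain n) (T ε : ℚ) (i j : Fin n) :
    (input C T ε).arr 2 (i * n + j) = C.M i j := by
  have hlt : (i : ℕ) * n + j < n * n := by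
    calc (i : ℕ) * n + j < i * n + n := by omega
      _ = (i + 1) * n := by ring
      _ ≤ n * n := Nat.mul_le_mul_right n i.2
  have heq : finProdFinEquiv.symm ⟨(i : ℕ) * n + j, hlt⟩ = (i, j) := by
    rw [Equiv.symm_apply_eq]
    ext
    simp [finProdFinEquiv]
    ring
  calc (input C T ε).arr 2 (i * n + j)
      = C.M (finProdFinEquiv.symm ⟨(i : ℕ) * n + j, hlt⟩).1
          (finProdFinEquiv.symm ⟨(i : ℕ) * n + j, hlt⟩).2 := dif_pos hlt
    _ = C.M i j := by rw [heq]

theorem runs_setupProg {n : ℕ} (C : MarkovChain n) {T ε : ℚ} (hT : 0 ≤ T) {K : ℕ}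
    (hK : ∀ j, (C.minProb ^ n ^ 2) ^ 2 * ε
      < 4 * (∑ i, |C.w i|) * ((2 * n ^ 2 : ℕ) : ℚ) ^ 2 * (1 - C.minProb ^ n ^ 2) ^ j → j < K) :
    Runs setupProg (input C T ε)
      ((n + 1) * (200 * n.lcmUpto + 200) + (20 * ⌊T⌋₊ + 40) + 120 * (n * n + 1) + 40 * (K + 2))
      (fun s => s.idx 1 = n.lcmUpto ∧ s.idx 5 = ⌊T⌋₊ ∧ ∃ k ≤ K,
        s.idx 10 = ⌊T⌋₊ + 2 * n ^ 2 * k ∧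
        4 * (∑ i, |C.w i|) * ((2 * n ^ 2 : ℕ) : ℚ) ^ 2 * (1 - C.minProb ^ n ^ 2) ^ k
          ≤ (C.minProb ^ n ^ 2) ^ 2 * ε) := by
  have hn := C.pos
  set s₀ := input C T ε with hs₀
  have i0 : s₀.idx 0 = n := rfl
  have hW : ∑ i, |C.w i| = ∑ i ∈ Finset.range n, |s₀.arr 1 i| := by
    rw [← Fin.sum_univ_eq_sum_range (fun i => |s₀.arr 1 i|)]
    simp [hs₀, input]
  refine Runs.mono (Runs.seq (runs_lcmProg s₀) fun s₁ h₁ f₁ => ?_) (a := (n + 1) *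
    (200 * n.lcmUpto + 200) + ((20 * ⌊T⌋₊ + 40) + (40 * (n * n + 1) + (40 * (n * n + 1)
      + (40 * (n + 1) + (40 * (K + 1) + 10)))))) (by nlinarith) fun s' h _ => h
  have r1 : s₁.reg 0 = T := f₁.reg 0 (by simp [Prog.WritesReg, lcmProg])
  have F₁ := f₁
  have hfl := runs_floorProg s₁ (by rwa [r1])
  rw [r1] at hfl
  refine Runs.seq hfl fun s₂ h₂ f₂ => ?_
  have F₂ := F₁.seq f₂
  refine Runs.seq (runs_minProg C s₂
    ((F₂.idx 0 (by simp [Prog.WritesIdx, lcmProg, floorProg])).trans i0)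
    fun i j => ?_) fun s₃ h₃ f₃ => ?_
  · rw [F₂.arr 2 (by simp [Prog.WritesArr, lcmProg, floorProg])]
    exact input_arr_two C T ε i j
  have F₃ := F₂.seq f₃
  refine Runs.seq (runs_powProg s₃
    ((F₃.idx 0 (by simp [Prog.WritesIdx, lcmProg, floorProg, minProg])).trans i0))
    fun s₄ h₄ f₄ => ?_
  have F₄ := F₃.seq f₄
  refine Runs.seq (runs_absSumProg s₄
    ((F₄.idx 0 (by simp [Prog.WritesIdx, lcmProg, floorProg, minProg, powProg])).trans i0))
    fun s₅ h₅ f₅ => ?_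
  have F₅ := F₄.seq f₅
  rw [F₄.arr 1 (by simp [Prog.WritesArr, lcmProg, floorProg, minProg, powProg]), ← hW] at h₅
  rw [h₃] at h₄
  refine Runs.seq (runs_roundsProg s₅
    ((F₅.idx 0 (by simp [Prog.WritesIdx, lcmProg, floorProg, minProg, powProg, absSumProg])).trans
      i0) ((f₅.reg 3 (by simp [Prog.WritesReg, absSumProg])).trans h₄) h₅
    (F₅.reg 1 (by simp [Prog.WritesReg, lcmProg, floorProg, minProg, powProg, absSumProg])) hK)
    fun s₆ h₆ f₆ => ?_
  have F₆ := F₅.seq f₆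
  have j0 : s₆.idx 0 = n := (F₆.idx 0 (by
    simp [Prog.WritesIdx, lcmProg, floorProg, minProg, powProg, absSumProg, roundsProg])).trans i0
  have G := ((f₃.seq f₄).seq f₅).seq f₆
  have j1 : s₆.idx 1 = n.lcmUpto := ((f₂.seq G).idx 1 (by
    simp [Prog.WritesIdx, floorProg, minProg, powProg, absSumProg, roundsProg])).trans h₁
  have j5 : s₆.idx 5 = ⌊T⌋₊ := by
    rw [G.idx 5 (by simp [Prog.WritesIdx, minProg, powProg, absSumProg, roundsProg])]
    exact ((Nat.floor_eq_iff hT).2 h₂).symm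
  refine Runs.of_loopFree trivial (by simp [Prog.cost, NExpr.cost]) ?_
  simp only [Prog.run, NExpr.eval, Function.update_self, j0, j5,
    Function.update_of_ne (show 1 ≠ 10 by decide), Function.update_of_ne (show 5 ≠ 10 by decide),
    j1, true_and, ← sq]
  exact ⟨_, h₆.1, rfl, h₆.2⟩

theorem runs_algorithm {n : ℕ} (C : MarkovChain n) {T ε : ℚ} (hT : 0 ≤ T) (hε : 0 < ε) {K : ℕ}
    (hK : ∀ j, (C.minProb ^ n ^ 2) ^ 2 * ε
      < 4 * (∑ i, |C.w i|) * ((2 * n ^ 2 : ℕ) : ℚ) ^ 2 * (1 - C.minProb ^ n ^ 2) ^ j → j < K) :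
    Runs algorithm (input C T ε)
      (5000 * ((n + 1) ^ 4 * (n.lcmUpto + 1) * (⌊T⌋₊ + 1) * (K + 1)))
      (fun s => |C.val (T : ℝ) - (s.reg 0 : ℝ)| ≤ (ε : ℝ)) := by
  have hn := C.pos
  set s₀ := input C T ε with hs₀
  set p := n.lcmUpto with hp
  set F := ⌊T⌋₊ with hF
  have hp0 : 0 < p := Nat.lcmUpto_pos n
  have hdvd : ∀ d, 0 < d → d ≤ n → d ∣ p := fun d hd hdn =>
    Finset.dvd_lcm (f := id) (Finset.mem_Icc.2 ⟨hd, hdn⟩)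
  have hcost : ((n + 1) * (200 * p + 200) + (20 * F + 40) + 120 * (n * n + 1) + 40 * (K + 2))
      + (200 * (n + 1) ^ 2 * (F + 2 * n ^ 2 * K + p + 2) + 200 * (F + 2) * (2 * n ^ 2 * K + p + 2))
      ≤ 5000 * ((n + 1) ^ 4 * (p + 1) * (F + 1) * (K + 1)) := by
    -- every factor on the right is positive
    have e1 : n + 1 ≤ (n + 1) ^ 4 := Nat.le_self_pow (by norm_num) _
    have e2 : (n + 1) ^ 2 ≤ (n + 1) ^ 4 := Nat.pow_le_pow_right (by omega) (by norm_num)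
    have e3 : 1 ≤ (n + 1) ^ 4 := Nat.one_le_pow _ _ (by omega)
    have e4 : 1 ≤ (n + 1) ^ 2 := Nat.one_le_pow _ _ (by omega)
    set A := (n + 1) ^ 4 with hA
    have hX : ∀ {a b c d : ℕ}, a ≤ A → b ≤ p + 1 → c ≤ F + 1 → d ≤ K + 1 →
        a * b * c * d ≤ A * (p + 1) * (F + 1) * (K + 1) := fun ha hb hc hd =>
      Nat.mul_le_mul (Nat.mul_le_mul (Nat.mul_le_mul ha hb) hc) hd
    have x1 := hX e1 (le_refl (p + 1)) (show 1 ≤ F + 1 by omega) (show 1 ≤ K + 1 by omega)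
    have x2 := hX e3 (show 1 ≤ p + 1 by omega) (le_refl (F + 1)) (show 1 ≤ K + 1 by omega)
    have x3 := hX e2 (show 1 ≤ p + 1 by omega) (show 1 ≤ F + 1 by omega) (show 1 ≤ K + 1 by omega)
    have x4 := hX e3 (show 1 ≤ p + 1 by omega) (show 1 ≤ F + 1 by omega) (le_refl (K + 1))
    have x5 := hX e2 (show 1 ≤ p + 1 by omega) (le_refl (F + 1)) (show 1 ≤ K + 1 by omega)
    have x6 := hX (le_refl A) (show 1 ≤ p + 1 by omega) (show 1 ≤ F + 1 by omega) (le_refl (K + 1))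
    have x7 := hX e2 (le_refl (p + 1)) (show 1 ≤ F + 1 by omega) (show 1 ≤ K + 1 by omega)
    have x8 := hX e2 (show 1 ≤ p + 1 by omega) (le_refl (F + 1)) (le_refl (K + 1))
    have x9 := hX e3 (le_refl (p + 1)) (le_refl (F + 1)) (show 1 ≤ K + 1 by omega)
    set X := A * (p + 1) * (F + 1) * (K + 1) with hXdef
    have hsq : (n + 1) ^ 2 * (n ^ 2 * K) ≤ A * (K + 1) := by
      rw [hA, show (n + 1) ^ 4 * (K + 1) = (n + 1) ^ 2 * ((n + 1) ^ 2 * (K + 1)) by ring]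
      exact Nat.mul_le_mul_left _ (Nat.mul_le_mul (Nat.pow_le_pow_left (by omega) 2) (by omega))
    have hnF : (F + 1) * (n ^ 2 * K) ≤ (n + 1) ^ 2 * (F + 1) * (K + 1) := by
      rw [show (n + 1) ^ 2 * (F + 1) * (K + 1) = (F + 1) * ((n + 1) ^ 2 * (K + 1)) by ring]
      exact Nat.mul_le_mul_left _ (Nat.mul_le_mul (Nat.pow_le_pow_left (by omega) 2) (by omega))
    have hnn : n * n + 1 ≤ (n + 1) ^ 2 := by nlinarith
    have hF2 : 200 * (F + 2) * (2 * n ^ 2 * K + p + 2)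
        ≤ 800 * ((F + 1) * (n ^ 2 * K)) + 800 * ((F + 1) * (p + 1)) := by
      calc 200 * (F + 2) * (2 * n ^ 2 * K + p + 2)
          ≤ 200 * (2 * (F + 1)) * (2 * n ^ 2 * K + 2 * (p + 1)) :=
            Nat.mul_le_mul (by omega) (by omega)
        _ = _ := by ring
    have hu : 200 * (n + 1) ^ 2 * (F + 2 * n ^ 2 * K + p + 2) = 200 * ((n + 1) ^ 2 * (F + 1))
        + 400 * ((n + 1) ^ 2 * (n ^ 2 * K)) + 200 * ((n + 1) ^ 2 * (p + 1)) := by ring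
    rw [hu]
    simp only [mul_one, one_mul] at x1 x2 x3 x4 x5 x6 x7 x8 x9
    have hl : (n + 1) * (200 * p + 200) = 200 * ((n + 1) * (p + 1)) := by ring
    have h9 : (F + 1) * (p + 1) = (p + 1) * (F + 1) := mul_comm _ _
    rw [hl]
    rw [h9] at hF2
    linarith
  refine Runs.mono (Runs.seq (runs_setupProg C hT hK) fun s₁ h₁ f₁ => ?_) hcost fun s h _ => h
  obtain ⟨h1, h5, k, hkK, h10, hk⟩ := h₁
  set B := F + 2 * n ^ 2 * k with hB
  have hBK : B ≤ F + 2 * n ^ 2 * K := Nat.add_le_add_left (Nat.mul_le_mul_left _ hkK) F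
  have i0 : s₁.idx 0 = n := f₁.idx 0 (by
    simp [Prog.WritesIdx, setupProg, lcmProg, floorProg, minProg, powProg, absSumProg, roundsProg])
  have r0 : s₁.reg 0 = T := f₁.reg 0 (by
    simp [Prog.WritesReg, setupProg, lcmProg, floorProg, minProg, powProg, absSumProg, roundsProg])
  have a0 : ∀ a, s₁.arr a = s₀.arr a := fun a => f₁.arr a (by
    simp [Prog.WritesArr, setupProg, lcmProg, floorProg, minProg, powProg, absSumProg, roundsProg])
  refine Runs.seq (Runs.mono (runs_utilityProg C s₁ i0 h10 h1 (fun i => ?_) (fun k hk => ?_)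
    (fun i => ?_) fun i j => ?_) (Nat.mul_le_mul_left _ (by omega)) fun s h _ => h)
    fun s₂ h₂ f₂ => ?_
  · simp [a0, hs₀, input]
  · simp [a0, hs₀, input, hk]
  · simp [a0, hs₀, input]
  · rw [a0]; exact input_arr_two C T ε i j
  have g5 := (f₂.idx 5 (by simp [Prog.WritesIdx, utilityProg, stepProg, rowProg])).trans h5
  have g10 := (f₂.idx 10 (by simp [Prog.WritesIdx, utilityProg, stepProg, rowProg])).trans h10
  have g1 := (f₂.idx 1 (by simp [Prog.WritesIdx, utilityProg, stepProg, rowProg])).trans h1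
  have gr := (f₂.reg 0 (by simp [Prog.WritesReg, utilityProg, stepProg, rowProg])).trans r0
  refine Runs.mono (runs_minimizeProg s₂ g5 g10 g1 gr (Nat.le_add_right _ _) h₂ rfl)
    (Nat.mul_le_mul_left _ (by omega)) fun s h _ => ?_
  obtain ⟨hray, hchord, hv⟩ := h
  refine C.abs_val_sub_le hT hε.le (Nat.floor_le hT) (Nat.lt_floor_add_one T) hp0
    (Nat.le_add_right _ _) (fun t ht => ?_) hray hchord hv
  have hp' : (p : ℚ) ≠ 0 := by exact_mod_cast hp0.ne'
  have hβ : 0 < C.minProb ^ n ^ 2 := pow_pos C.minProb_pos _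
  rw [mul_div_cancel₀ _ hp']
  refine (mul_le_mul_of_nonneg_right (Nat.lt_floor_add_one T).le (abs_nonneg _)).trans
    ((C.mul_abs_utility_add_sub_le C.exists_abs_w_le hdvd F k t ht).trans ?_)
  rw [div_pow, ← mul_div_assoc, div_le_iff₀ (by positivity)]
  linarith

/-! ### The running time -/

theorem lcmUpto_le (n : ℕ) : (n.lcmUpto : ℝ) ≤ 2 ^ (8 * n) := by
  have h1 := Chebyshev.psi_le_const_mul_self (Nat.cast_nonneg (α := ℝ) n)
  rw [Chebyshev.psi_eq_log_lcmUpto] at h1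
  have h4 : Real.log 4 = 2 * Real.log 2 := by
    rw [show (4 : ℝ) = 2 ^ 2 by norm_num, Real.log_pow]; norm_num
  have h2 := Real.log_two_gt_d9
  have hpos : (0 : ℝ) < n.lcmUpto := by exact_mod_cast n.lcmUpto_pos
  rw [← Real.log_le_log_iff hpos (by positivity), Real.log_pow]
  refine h1.trans ?_
  rw [h4]
  push_cast
  have : (0 : ℝ) ≤ n := Nat.cast_nonneg n
  nlinarith

end RAM

namespace MarkovChain

variable {n : ℕ} (C : MarkovChain n)

theorem sum_abs_w_le : ((∑ i, |C.w i| : ℚ) : ℝ) ≤ n * ‖C.w‖ := by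
  have : ∀ i, ((|C.w i| : ℚ) : ℝ) ≤ ‖C.w‖ := fun i => by
    refine le_trans (le_of_eq ?_) (norm_le_pi_norm C.w i)
    rw [← Rat.norm_cast_real, Real.norm_eq_abs, Rat.cast_abs]
  push_cast at this ⊢
  refine (Finset.sum_le_card_nsmul _ _ _ fun i _ => this i).trans ?_
  simp

/-- The factor of the running time that depends on the mixing time: it is `1` if the chain is
deterministic. -/
noncomputable def mixingFactor (ε : ℚ) : ℝ :=
  if C.minProb = 1 then 1
  else 1 / (C.minProb : ℝ) ^ n ^ 3 * max 1 (Real.log (n * ‖C.w‖ / ε))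

/-- A bound for the number of rounds until the error is small. As `2 ≤ n` unless `α = 1`, the gap
between the exponents `n²` and `n³` leaves room for a factor `1 / α`, and so for `ln (1 / α)`. -/
theorem exists_rounds {ε : ℚ} (hε : 0 < ε) : ∃ K : ℕ,
    (∀ j, (C.minProb ^ n ^ 2) ^ 2 * ε
      < 4 * (∑ i, |C.w i|) * ((2 * n ^ 2 : ℕ) : ℚ) ^ 2 * (1 - C.minProb ^ n ^ 2) ^ j → j < K) ∧
    (K + 1 : ℝ) ≤ 21 * n ^ 4 * C.mixingFactor ε := by
  have hn : (1 : ℝ) ≤ n := by exact_mod_cast C.pos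
  have hn4 : (1 : ℝ) ≤ n ^ 4 := one_le_pow₀ hn
  by_cases hα1 : C.minProb = 1
  · refine ⟨1, fun j hj => ?_, ?_⟩
    · by_contra! h
      have hj0 : j ≠ 0 := by omega
      simp only [hα1, one_pow, sub_self, zero_pow hj0, mul_zero, one_mul] at hj
      linarith
    · rw [mixingFactor, if_pos hα1]
      push_cast
      linarith
  obtain ⟨-, hn2⟩ := C.minProb_le_half hα1
  set L := max 1 (Real.log (n * ‖C.w‖ / ε)) with hL
  have hα0 : (0 : ℝ) < C.minProb := by exact_mod_cast C.minProb_pos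
  have hαle : (C.minProb : ℝ) ≤ 1 := by exact_mod_cast C.minProb_le_one
  set α : ℝ := (C.minProb : ℝ) with hα
  set β := α ^ n ^ 2 with hβ
  have hβ0 : 0 < β := pow_pos hα0 _
  have hβ1 : β ≤ 1 := pow_le_one₀ hα0.le hαle
  have hεR : (0 : ℝ) < ε := by exact_mod_cast hε
  have hL1 : 1 ≤ L := le_max_left _ _
  set x := (16 * n ^ 4 + 2 * n ^ 2 / α + L) / β with hx
  have hx0 : 0 ≤ x := by positivity
  refine ⟨⌊x⌋₊ + 1, fun j hj => Nat.lt_succ_of_le (Nat.le_floor ?_), ?_⟩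
  · have hjR : β ^ 2 * ε < 4 * ((∑ i, |C.w i| : ℚ) : ℝ) * (2 * n ^ 2) ^ 2 * (1 - β) ^ j := by
      rw [hβ, hα]; exact_mod_cast hj
    have hS := C.sum_abs_w_le
    set S : ℝ := ((∑ i, |C.w i| : ℚ) : ℝ)
    have hexp : (1 - β) ^ j ≤ Real.exp (-(β * j)) := by
      have := Real.one_sub_le_exp_neg β
      calc (1 - β) ^ j ≤ Real.exp (-β) ^ j := pow_le_pow_left₀ (by linarith) this j
        _ = Real.exp (-(β * j)) := by rw [← Real.exp_nat_mul]; ring_nf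
    have h1 : β ^ 2 * ε < 16 * n ^ 4 * (n * ‖C.w‖) * Real.exp (-(β * j)) := by
      refine hjR.trans_le (mul_le_mul ?_ hexp (pow_nonneg (by linarith) j) (by positivity))
      have : (0 : ℝ) ≤ 16 * n ^ 4 := by positivity
      calc 4 * S * (2 * (n : ℝ) ^ 2) ^ 2 = 16 * n ^ 4 * S := by ring
        _ ≤ _ := mul_le_mul_of_nonneg_left hS this
    have hw0 : 0 < (n : ℝ) * ‖C.w‖ := by
      refine lt_of_le_of_ne (by positivity) fun h => ?_
      rw [← h] at h1
      simp only [mul_zero, zero_mul] at h1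
      exact absurd h1 (not_lt.2 (by positivity))
    have h2 : 2 * (n ^ 2 * Real.log α) + Real.log ε
        < Real.log (16 * n ^ 4) + Real.log (n * ‖C.w‖) - β * j := by
      have := Real.log_lt_log (by positivity) h1
      rw [Real.log_mul (by positivity) hεR.ne', Real.log_mul (by positivity) (by positivity),
        Real.log_mul (by positivity) hw0.ne', Real.log_exp, Real.log_pow, hβ, Real.log_pow] at this
      push_cast at this
      linarith
    have h3 : Real.log (16 * n ^ 4) ≤ 16 * n ^ 4 := Real.log_le_self (by positivity)
    have h4 : -Real.log α ≤ 1 / α := by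
      rw [← Real.log_inv, one_div]
      exact Real.log_le_self (by positivity)
    have h5 : Real.log (n * ‖C.w‖) - Real.log ε ≤ L := by
      rw [← Real.log_div hw0.ne' hεR.ne']
      exact le_max_right _ _
    have h6 : 2 * (n : ℝ) ^ 2 * -Real.log α ≤ 2 * n ^ 2 * (1 / α) :=
      mul_le_mul_of_nonneg_left h4 (by positivity)
    rw [hx, le_div_iff₀ hβ0]
    have h7 : 2 * (n : ℝ) ^ 2 * (1 / α) = 2 * n ^ 2 / α := by ring
    linarith
  · rw [mixingFactor, if_neg hα1]
    have hfl := Nat.floor_le hx0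
    push_cast
    have hαn : α ^ n ^ 3 ≤ α * β := by
      rw [hβ, ← pow_succ']
      refine pow_le_pow_of_le_one hα0.le hαle ?_
      nlinarith [sq_nonneg n]
    have hαβ : 1 / (α * β) ≤ 1 / α ^ n ^ 3 := one_div_le_one_div_of_le (by positivity) hαn
    have hαβ1 : 1 ≤ 1 / (α * β) := by
      rw [le_div_iff₀ (by positivity)]
      nlinarith
    have hinv : 1 / β ≤ 1 / (α * β) := one_div_le_one_div_of_le (by positivity) (by nlinarith)
    have h2 : (n : ℝ) ^ 2 ≤ n ^ 4 := pow_le_pow_right₀ hn (by norm_num)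
    set V := 1 / (α * β) with hV
    have hxV : x ≤ 19 * n ^ 4 * (V * L) := by
      have hxe : x = 16 * n ^ 4 * (1 / β) + 2 * n ^ 2 * V + L * (1 / β) := by
        rw [hx, hV]; field_simp
      have hVL : V ≤ V * L := le_mul_of_one_le_right (by linarith) hL1
      have t1 : 16 * (n : ℝ) ^ 4 * (1 / β) ≤ 16 * n ^ 4 * (V * L) :=
        mul_le_mul_of_nonneg_left (hinv.trans hVL) (by positivity)
      have t2 : 2 * (n : ℝ) ^ 2 * V ≤ 2 * n ^ 4 * (V * L) :=
        mul_le_mul (by linarith) hVL (by linarith) (by positivity)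
      have t3 : L * (1 / β) ≤ n ^ 4 * (V * L) := by
        calc L * (1 / β) ≤ L * V := mul_le_mul_of_nonneg_left hinv (by linarith)
          _ = 1 * (V * L) := by ring
          _ ≤ n ^ 4 * (V * L) := mul_le_mul_of_nonneg_right hn4 (by nlinarith)
      linarith
    have hV1 : 1 ≤ V * L := by nlinarith
    have hfin : V * L ≤ 1 / α ^ n ^ 3 * L := mul_le_mul_of_nonneg_right hαβ (by linarith)
    have hlast : 21 * (n : ℝ) ^ 4 * (V * L) ≤ 21 * n ^ 4 * (1 / α ^ n ^ 3 * L) :=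
      mul_le_mul_of_nonneg_left hfin (by positivity)
    nlinarith

theorem mixingFactor_le (ε : ℚ) :
    C.mixingFactor ε ≤ 1 / (C.minProb : ℝ) ^ n ^ 3 * max 1 (Real.log (n * ‖C.w‖ / ε)) := by
  rw [mixingFactor]
  split_ifs with h
  · simp [h]
  · exact le_rfl

/-- `-ln K₃ ≤ α ^ (n³)`, because `α ≤ 1/2` unless `α = 1`. -/
theorem mixingFactor_le_max (ε : ℚ) :
    C.mixingFactor ε
      ≤ max 1 (min (-1) (Real.log (ε / (n * ‖C.w‖))) / Real.log C.K₃) := by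
  rw [mixingFactor]
  split_ifs with h
  · exact le_max_left _ _
  refine le_trans ?_ (le_max_right _ _)
  obtain ⟨hhalf, hn2⟩ := C.minProb_le_half h
  have hα0 : (0 : ℝ) < C.minProb := by exact_mod_cast C.minProb_pos
  have hαh : 2 * (C.minProb : ℝ) ≤ 1 := by exact_mod_cast hhalf
  have hn : (1 : ℝ) ≤ n := by exact_mod_cast C.pos
  have hn3 : n ^ 3 ≠ 0 := by have := C.pos; positivity
  set y : ℝ := (C.minProb : ℝ) ^ n ^ 3 with hy
  have hy0 : 0 < y := pow_pos hα0 _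
  have hyh : y ≤ 1 / 2 := (pow_le_of_le_one hα0.le (by linarith) hn3).trans (by linarith)
  have hlog1 : -(2 * y) ≤ Real.log (1 - y) := by
    refine le_trans ?_ (Real.one_sub_inv_le_log_of_pos (by linarith))
    rw [← one_div, le_sub_comm, div_le_iff₀ (by linarith)]
    nlinarith
  have hlog0 : Real.log (1 - y) < 0 := Real.log_neg (by linarith) (by linarith)
  have hK : Real.log C.K₃ = 1 / (3 * (n : ℝ) ^ 2) * Real.log (1 - y) := by
    rw [K₃, Real.log_rpow (by linarith)]
  have hc0 : 0 < 1 / (3 * (n : ℝ) ^ 2) := by positivity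
  have hc1 : 1 / (3 * (n : ℝ) ^ 2) ≤ 1 / 2 := by
    apply one_div_le_one_div_of_le <;> nlinarith
  have hK0 : Real.log C.K₃ < 0 := by rw [hK]; exact mul_neg_of_pos_of_neg hc0 hlog0
  have hKy : -Real.log C.K₃ ≤ y := by rw [hK]; nlinarith
  have hmin : min (-1) (Real.log (ε / (n * ‖C.w‖))) = -max 1 (Real.log (n * ‖C.w‖ / ε)) := by
    rw [← inv_div, Real.log_inv, ← min_neg_neg]
  rw [hmin, neg_div, ← div_neg, div_mul_eq_mul_div, one_mul]
  exact div_le_div_of_nonneg_left (le_trans zero_le_one (le_max_left _ _)) (by linarith) hKy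

theorem max_log_le {ε : ℚ} (hε : 0 < ε) :
    max 1 (Real.log (n * ‖C.w‖ / ε)) ≤ n * max 1 (Real.log (‖C.w‖ / ε)) := by
  have hn : (1 : ℝ) ≤ n := by exact_mod_cast C.pos
  have hεR : (0 : ℝ) < ε := by exact_mod_cast hε
  have h1 : 1 ≤ max 1 (Real.log (‖C.w‖ / ε)) := le_max_left _ _
  have h2 : Real.log (‖C.w‖ / ε) ≤ max 1 (Real.log (‖C.w‖ / ε)) := le_max_right _ _
  refine max_le (by nlinarith) ?_
  rcases (norm_nonneg C.w).eq_or_lt with h | h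
  · rw [← h]
    simp only [mul_zero, zero_div, Real.log_zero, zero_le_one, sup_of_le_left, mul_one]
    linarith
  · rw [mul_div_assoc, Real.log_mul (by positivity) (by positivity)]
    have := Real.log_le_sub_one_of_pos (show (0 : ℝ) < n by linarith)
    nlinarith

end MarkovChain

namespace RAM

theorem approximatesWithin_algorithm {n : ℕ} (C : MarkovChain n) {T ε : ℚ} (hT : 0 ≤ T)
    (hε : 0 < ε) {b : ℝ}
    (hb : 420000 * ((n : ℝ) + 1) ^ 8 * 2 ^ (8 * n) * max 1 (T : ℝ) * C.mixingFactor ε ≤ b) :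
    ApproximatesWithin algorithm C T ε b := by
  obtain ⟨K, hK, hKb⟩ := C.exists_rounds hε
  obtain ⟨k, s, he, hk, hs⟩ := runs_algorithm C hT hε hK
  refine ⟨k, s, he, hs, le_trans ?_ hb⟩
  have hkR : (k : ℝ) ≤ 5000 * ((n + 1) ^ 4 * (n.lcmUpto + 1) * (⌊T⌋₊ + 1) * (K + 1)) := by
    exact_mod_cast hk
  have hp : (n.lcmUpto : ℝ) + 1 ≤ 2 * 2 ^ (8 * n) := by
    have : (1 : ℝ) ≤ 2 ^ (8 * n) := one_le_pow₀ (by norm_num)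
    linarith [lcmUpto_le n]
  have hF : ((⌊T⌋₊ : ℕ) : ℝ) + 1 ≤ 2 * max 1 (T : ℝ) := by
    have h1 : ((⌊T⌋₊ : ℕ) : ℝ) ≤ T := by exact_mod_cast Nat.floor_le hT
    linarith [le_max_left 1 (T : ℝ), le_max_right 1 (T : ℝ)]
  have hG : 0 ≤ C.mixingFactor ε := by
    by_contra! h
    have h4 : (21 : ℝ) * n ^ 4 * C.mixingFactor ε ≤ 0 :=
      mul_nonpos_of_nonneg_of_nonpos (by positivity) h.le
    have : (0 : ℝ) ≤ K := Nat.cast_nonneg K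
    linarith
  have hK' : (K + 1 : ℝ) ≤ 21 * (n + 1) ^ 4 * C.mixingFactor ε := by
    refine hKb.trans (mul_le_mul_of_nonneg_right ?_ hG)
    gcongr
    linarith
  calc (k : ℝ) ≤ 5000 * ((n + 1) ^ 4 * (n.lcmUpto + 1) * (⌊T⌋₊ + 1) * (K + 1)) := hkR
    _ ≤ 5000 * ((n + 1) ^ 4 * (2 * 2 ^ (8 * n)) * (2 * max 1 (T : ℝ))
          * (21 * (n + 1) ^ 4 * C.mixingFactor ε)) := by gcongr
    _ = _ := by ring

end RAM

theorem mainTheorem3 :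
    ∃ A : RAM.Prog,
      -- the general bound
      (∃ (P : Polynomial ℕ) (c : ℕ), ∀ (n : ℕ) (C : MarkovChain n) (T ε : ℚ), 0 ≤ T → 0 < ε →
        RAM.ApproximatesWithin A C T ε
          ((P.eval n : ℕ) * max 1 (T : ℝ) *
            max 1 (min (-1) (Real.log (ε / (n * ‖C.w‖))) / Real.log C.K₃) *
            2 ^ (c * n))) ∧
      -- the bound for constant `α` (with constants that do not even depend on `α`)
      (∃ (P : Polynomial ℕ) (c : ℕ), ∀ (n : ℕ) (C : MarkovChain n) (T ε : ℚ), 0 ≤ T → 0 < ε →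
        RAM.ApproximatesWithin A C T ε
          ((P.eval n : ℕ) * 2 ^ (c * n) / (C.minProb : ℝ) ^ n ^ 3 * max 1 (T : ℝ) *
            max 1 (Real.log (n * ‖C.w‖ / ε)))) ∧
      -- the bound for constant `n`
      (∀ n : ℕ, ∃ c e : ℕ, ∀ (C : MarkovChain n) (T ε : ℚ), 0 ≤ T → 0 < ε →
        RAM.ApproximatesWithin A C T ε
          (c * (1 / (C.minProb : ℝ) ^ e) * max 1 (T : ℝ) *
            max 1 (Real.log (‖C.w‖ / ε)))) := by
  set P : Polynomial ℕ := 420000 * (Polynomial.X + 1) ^ 8 with hP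
  have hPn : ∀ n : ℕ, ((P.eval n : ℕ) : ℝ) = 420000 * ((n : ℝ) + 1) ^ 8 := by
    intro n
    simp [hP]
  refine ⟨RAM.algorithm, ⟨P, 8, fun n C T ε hT hε => ?_⟩, ⟨P, 8, fun n C T ε hT hε => ?_⟩,
    fun n => ⟨P.eval n * 2 ^ (8 * n) * n, n ^ 3, fun C T ε hT hε => ?_⟩⟩ <;>
    refine RAM.approximatesWithin_algorithm C hT hε ?_
  · rw [hPn]
    calc _ ≤ 420000 * ((n : ℝ) + 1) ^ 8 * 2 ^ (8 * n) * max 1 (T : ℝ) *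
          max 1 (min (-1) (Real.log (ε / (n * ‖C.w‖))) / Real.log C.K₃) :=
          mul_le_mul_of_nonneg_left (C.mixingFactor_le_max ε) (by positivity)
      _ = _ := by ring
  · rw [hPn]
    calc _ ≤ 420000 * ((n : ℝ) + 1) ^ 8 * 2 ^ (8 * n) * max 1 (T : ℝ) *
          (1 / (C.minProb : ℝ) ^ n ^ 3 * max 1 (Real.log (n * ‖C.w‖ / ε))) :=
          mul_le_mul_of_nonneg_left (C.mixingFactor_le ε) (by positivity)
      _ = _ := by ring
  · have hα0 : (0 : ℝ) < C.minProb := by exact_mod_cast C.minProb_pos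
    push_cast
    rw [hPn]
    calc _ ≤ 420000 * ((n : ℝ) + 1) ^ 8 * 2 ^ (8 * n) * max 1 (T : ℝ) *
          (1 / (C.minProb : ℝ) ^ n ^ 3 * (n * max 1 (Real.log (‖C.w‖ / ε)))) :=
          mul_le_mul_of_nonneg_left ((C.mixingFactor_le ε).trans
            (mul_le_mul_of_nonneg_left (C.max_log_le hε) (by positivity))) (by positivity)
      _ = _ := by ring
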